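/- Conventions. For $n\in\mathbb N\cup\{\omega\}$, let $\mathbf{Glob}_n$ be the category of $n$-globular sets (sets $X_k$ for $k\in\mathbb N$, $k\le n$, with sources and targets $\partial^-_k,\partial^+_k\colon X_{k+1}\to X_k$ such that $\partial^\epsilon_k\partial^-_{k+1}=\partial^\epsilon_k\partial^+_{k+1}$, and maps commuting with sources and targets), and let $\mathbf{Cat}_n$ be the category of strict $n$-categories: $n$-globular sets $C$ with identities $\mathrm{id}\colon C_k\to C_{k+1}$ ($k<n$) and compositions $*_i\colon C_k\times_i C_k\to C_k$ ($i<k\le n$, defined on pairs $(u,v)$ with $\partial^+_iu=\partial^-_iv$), satisfying the usual axioms on sources and targets, unitality, associativity, functoriality of identities and exchange; its morphisms are the maps of $n$-globular sets that preserve identities and compositions. Let $U_n\colon\mathbf{Cat}_n\to\mathbf{Glob}_n$ be the forgetful functor. For $m\le n$ there are truncation functors $(-)_{\le m}$ from $\mathbf{Glob}_n$ to $\mathbf{Glob}_m$ and from $\mathbf{Cat}_n$ to $\mathbf{Cat}_m$, which forget the cells of dimension $>m$. On globular sets, truncation has a left adjoint, the inclusion $(-)^{\uparrow n}\colon\mathbf{Glob}_m\to\mathbf{Glob}_n$,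 which adds no cells; let $\iota$ be the counit of this adjunction. Let $(T,\eta,\mu)$ be a monad on $\mathbf{Glob}_\omega$. For $k\in\mathbb N$, let $T^k=(T((-)^{\uparrow\omega}))_{\le k}$ be the induced monad on $\mathbf{Glob}_k$, whose unit and multiplication come from $\eta,\mu$ and the unit and counit of the adjunction between inclusion and truncation. Put $T^\omega=T$ and, for $k\in\mathbb N\cup\{\omega\}$, let $\mathbf{Alg}_k$ be the category of $T^k$-algebras, with forgetful functor $\mathcal U_k\colon\mathbf{Alg}_k\to\mathbf{Glob}_k$. For $k<l\le\omega$, truncation of algebras $\mathbf{Alg}_l\to\mathbf{Alg}_k$ maps $(X,h\colon T^lX\to X)$ to $X_{\le k}$ with the structure map $$T^k(X_{\le k})\xrightarrow{\ (T^l\iota_X)_{\le k}\ }(T^lX)_{\le k}\xrightarrow{\ h_{\le k}\ }X_{\le k},$$ where $(X_{\le k})^{\uparrow\omega}$ is identified with $((X_{\le k})^{\uparrow l})^{\uparrow\omega}$ when $l<\omega$, and maps a morphism $f$ to $f_{\le k}$. Theorem. The functor $U_\omega$ has a left adjoint. Let $F_\omega\dashv U_\omega$ be any such adjunction and let $T$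 be the monad on $\mathbf{Glob}_\omega$ that it induces (the monad of strict $\omega$-categories). Then the comparison functor $H_\omega\colon\mathbf{Cat}_\omega\to\mathbf{Alg}_\omega$ is an equivalence of categories with $\mathcal U_\omega H_\omega=U_\omega$, and there is a family of equivalences of categories $(H_k\colon\mathbf{Cat}_k\to\mathbf{Alg}_k)_{k\in\mathbb N}$ such that, for every $k\in\mathbb N$, the following equalities of functors hold: $$(-)_{\le k}\circ H_{k+1}=H_k\circ(-)_{\le k}\colon\mathbf{Cat}_{k+1}\to\mathbf{Alg}_k,\qquad (-)_{\le k}\circ H_\omega=H_k\circ(-)_{\le k}\colon\mathbf{Cat}_\omega\to\mathbf{Alg}_k,\qquad \mathcal U_kH_k=U_k.$$ -/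

import Mathlib

open CategoryTheory

universe v₁ v₂ u₁ u₂ u

/-! ## Monads, adjunctions and functors between categories of algebras -/

section MndFunctors

variable {C : Type u₁} [Category.{v₁} C] {D : Type u₂} [Category.{v₂} D]

/-- Given an adjunction `L ⊣ R : C ⥤ D` and a monad `S` on `C`, the monad `R S L` on `D`. -/
@[simps! obj map η μ]
def pullMonad (S : CategoryTheory.Monad C) {L : D ⥤ C} {R : C ⥤ D} (adj : L ⊣ R) :
    CategoryTheory.Monad D where
  toFunctor := L ⋙ S.toFunctor ⋙ R
  η :=
    { app := fun X => adj.unit.app X ≫ R.map (S.η.app (L.obj X))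
      naturality := fun X Y f => by
        have h := S.η.naturality (L.map f)
        simp only [Functor.id_map] at h
        have h2 := adj.unit.naturality f
        simp only [Functor.id_map, Functor.comp_map] at h2
        simp only [Functor.id_map, Functor.comp_map, Category.assoc]
        rw [← R.map_comp, ← h, R.map_comp, ← Category.assoc, h2, Category.assoc] }
  μ :=
    { app := fun X =>
        R.map (S.map (adj.counit.app (S.obj (L.obj X))) ≫ S.μ.app (L.obj X))
      naturality := fun X Y f => by
        have h := S.μ.naturality (L.map f)
        simp only [Functor.comp_map] at h
        have h2 := adj.counit.naturality (S.map (L.map f))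
        simp only [Functor.id_map, Functor.comp_map] at h2
        simp only [Functor.comp_map]
        rw [← R.map_comp, ← R.map_comp, ← Category.assoc, ← S.map_comp, h2, S.map_comp,
          Category.assoc, Category.assoc, h] }
  assoc := fun X => by
    have h2 := adj.counit_naturality
      (S.map (adj.counit.app (S.obj (L.obj X))) ≫ S.μ.app (L.obj X))
    have h3 : S.map (S.map (adj.counit.app (S.obj (L.obj X)))) ≫ S.μ.app (S.obj (L.obj X)) =
        S.μ.app (L.obj (R.obj (S.obj (L.obj X)))) ≫ S.map (adj.counit.app (S.obj (L.obj X))) :=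
      S.μ.naturality (adj.counit.app (S.obj (L.obj X)))
    simp only [Functor.comp_map, Functor.comp_obj]
    rw [← R.map_comp, ← R.map_comp, ← Category.assoc, ← S.map_comp, h2]
    congr 1
    simp only [Functor.map_comp, Category.assoc]
    rw [S.assoc, reassoc_of% h3]
    rfl
  left_unit := fun X => by
    have h : adj.counit.app (S.obj (L.obj X)) ≫ S.η.app (S.obj (L.obj X)) =
        S.η.app (L.obj (R.obj (S.obj (L.obj X)))) ≫ S.map (adj.counit.app (S.obj (L.obj X))) :=
      S.η.naturality (adj.counit.app (S.obj (L.obj X)))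
    simp only [Functor.comp_obj, Category.assoc]
    rw [← R.map_comp, ← Category.assoc (S.η.app _), ← h, Category.assoc, S.left_unit,
      Category.comp_id]
    exact adj.right_triangle_components _
  right_unit := fun X => by
    have h : L.map (R.map (S.η.app (L.obj X))) ≫ adj.counit.app (S.obj (L.obj X)) =
        adj.counit.app (L.obj X) ≫ S.η.app (L.obj X) := adj.counit_naturality _
    have h2 : S.map (L.map (adj.unit.app X ≫ R.map (S.η.app (L.obj X)))) ≫
        S.map (adj.counit.app (S.obj (L.obj X))) ≫ S.μ.app (L.obj X) =
        𝟙 (S.obj (L.obj X)) := by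
      have h3 : L.map (adj.unit.app X) ≫ adj.counit.app (L.obj X) = 𝟙 (L.obj X) :=
        adj.left_triangle_components X
      rw [← Category.assoc, ← S.map_comp, L.map_comp, Category.assoc, h, reassoc_of% h3]
      exact S.right_unit _
    exact (R.map_comp _ _).symm.trans ((congrArg R.map h2).trans (R.map_id _))

/-- A monad functor `(F, α)` from a monad `S` on `C` to a monad `T` on `D`. -/
structure MndFunctor (S : CategoryTheory.Monad C) (T : CategoryTheory.Monad D) where
  /-- the underlying functor -/
  F : C ⥤ D
  /-- the natural transformation `T F ⟶ F S` -/
  α : F ⋙ T.toFunctor ⟶ S.toFunctor ⋙ F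
  unit_α : ∀ X : C, T.η.app (F.obj X) ≫ α.app X = F.map (S.η.app X)
  mul_α : ∀ X : C, T.μ.app (F.obj X) ≫ α.app X =
    T.map (α.app X) ≫ α.app (S.obj X) ≫ F.map (S.μ.app X)

/-- The functor between Eilenberg-Moore categories induced by a monad functor `(F, α)`:
it maps an algebra `(X, h)` to `(F X, F h ∘ α_X)`, and an algebra morphism `f` to `F f`. -/
@[simps]
def MndFunctor.algebraFunctor {S : CategoryTheory.Monad C} {T : CategoryTheory.Monad D}
    (Φ : MndFunctor S T) : S.Algebra ⥤ T.Algebra where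
  obj A :=
    { A := Φ.F.obj A.A
      a := Φ.α.app A.A ≫ Φ.F.map A.a
      unit := by
        rw [← Category.assoc, Φ.unit_α, ← Φ.F.map_comp, A.unit]
        exact Φ.F.map_id _
      assoc := by
        have h := Φ.α.naturality A.a
        simp only [Functor.comp_map] at h
        rw [← Category.assoc, Φ.mul_α]
        simp only [Category.assoc, Functor.map_comp]
        rw [← Category.assoc (T.map (Φ.F.map A.a)), h, Category.assoc,
          ← Φ.F.map_comp, A.assoc, Φ.F.map_comp] }
  map {A B} f :=
    { f := Φ.F.map f.f
      h := by
        have h := Φ.α.naturality f.f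
        simp only [Functor.comp_map] at h
        change T.map (Φ.F.map f.f) ≫ Φ.α.app B.A ≫ Φ.F.map B.a =
          (Φ.α.app A.A ≫ Φ.F.map A.a) ≫ Φ.F.map f.f
        rw [reassoc_of% h, Category.assoc, ← Φ.F.map_comp, f.h, Φ.F.map_comp] }

/-- Given an adjunction `L ⊣ R : C ⥤ D` with counit `ε` and a monad `S` on `C`, the monad
functor `(R, R S ε)` from `S` to `R S L`. -/
@[simps F α]
def MndFunctor.ofAdjunction (S : CategoryTheory.Monad C) {L : D ⥤ C} {R : C ⥤ D}
    (adj : L ⊣ R) : MndFunctor S (pullMonad S adj) where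
  F := R
  α :=
    { app := fun X => R.map (S.map (adj.counit.app X))
      naturality := fun X Y f => by
        change R.map (S.map (L.map (R.map f))) ≫ R.map (S.map (adj.counit.app Y)) =
          R.map (S.map (adj.counit.app X)) ≫ R.map (S.map f)
        have h : L.map (R.map f) ≫ adj.counit.app Y = adj.counit.app X ≫ f :=
          adj.counit.naturality f
        rw [← R.map_comp, ← R.map_comp, ← S.map_comp, ← S.map_comp, h] }
  unit_α := fun X => by
    have h : adj.counit.app X ≫ S.η.app X =
        S.η.app (L.obj (R.obj X)) ≫ S.map (adj.counit.app X) :=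
      S.η.naturality (adj.counit.app X)
    change (adj.unit.app (R.obj X) ≫ R.map (S.η.app (L.obj (R.obj X)))) ≫
      R.map (S.map (adj.counit.app X)) = R.map (S.η.app X)
    rw [Category.assoc, ← R.map_comp, ← h, R.map_comp, adj.right_triangle_components_assoc]
  mul_α := fun X => by
    have h : S.map (S.map (adj.counit.app X)) ≫ S.μ.app X =
        S.μ.app (L.obj (R.obj X)) ≫ S.map (adj.counit.app X) :=
      S.μ.naturality (adj.counit.app X)
    have h2 : L.map (R.map (S.map (adj.counit.app X))) ≫ adj.counit.app (S.obj X) =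
        adj.counit.app (S.obj (L.obj (R.obj X))) ≫ S.map (adj.counit.app X) :=
      adj.counit.naturality (S.map (adj.counit.app X))
    change R.map (S.map (adj.counit.app (S.obj (L.obj (R.obj X)))) ≫
        S.μ.app (L.obj (R.obj X))) ≫ R.map (S.map (adj.counit.app X)) =
      R.map (S.map (L.map (R.map (S.map (adj.counit.app X))))) ≫
        R.map (S.map (adj.counit.app (S.obj X))) ≫ R.map (S.μ.app X)
    rw [← R.map_comp, ← R.map_comp, ← R.map_comp, Category.assoc, ← h, ← Category.assoc,
      ← Category.assoc, ← S.map_comp, ← S.map_comp, h2]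

theorem map_comp_mu_aux (T : CategoryTheory.Monad C) {X Y U V W : C} (j : X ⟶ Y)
    (c : W ⟶ T.obj X) (p : W ⟶ V) (q : V ⟶ U) (r : U ⟶ T.obj Y)
    (h : c ≫ T.map j = p ≫ q ≫ r) :
    (T.map c ≫ T.μ.app X) ≫ T.map j = T.map p ≫ T.map q ≫ T.map r ≫ T.μ.app Y := by
  have h2 : T.map (T.map j) ≫ T.μ.app Y = T.μ.app X ≫ T.map j := T.μ.naturality j
  rw [Category.assoc, ← h2, ← Category.assoc, ← T.map_comp, h]
  simp only [Functor.map_comp, Category.assoc]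

end MndFunctors

/-! ## Globular sets -/

theorem ENat.natCast_le_of_le {i k : ℕ} {n : ℕ∞} (hik : i ≤ k) (hk : (k : ℕ∞) ≤ n) :
    (i : ℕ∞) ≤ n :=
  le_trans (Nat.cast_le.mpr hik) hk

theorem ENat.natCast_le_of_succ_le {k : ℕ} {n : ℕ∞} (hk : ((k + 1 : ℕ) : ℕ∞) ≤ n) :
    (k : ℕ∞) ≤ n :=
  ENat.natCast_le_of_le (Nat.le_succ k) hk

open ENat (natCast_le_of_le natCast_le_of_succ_le)

/-- An `n`-globular set, for `n ∈ ℕ ∪ {ω}` (here `ω` is `⊤ : ℕ∞`). The source operations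
`∂⁻ₖ` are the maps `bd false`, the target operations `∂⁺ₖ` are the maps `bd true`. -/
structure GlobSet (n : ℕ∞) where
  /-- the `k`-globes, for `k ≤ n` -/
  cell : ∀ k : ℕ, (k : ℕ∞) ≤ n → Type u
  /-- source and target operations -/
  bd : ∀ (_ε : Bool) {k : ℕ} (hk : ((k + 1 : ℕ) : ℕ∞) ≤ n),
    cell (k + 1) hk → cell k (natCast_le_of_succ_le hk)
  globular : ∀ (ε : Bool) {k : ℕ} (hk : ((k + 2 : ℕ) : ℕ∞) ≤ n) (u : cell (k + 2) hk),
    bd ε (natCast_le_of_succ_le hk) (bd false hk u) =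
      bd ε (natCast_le_of_succ_le hk) (bd true hk u)

namespace GlobSet

variable {n : ℕ∞}

/-- Morphisms of `n`-globular sets. -/
@[ext]
structure Hom (X Y : GlobSet.{u} n) where
  app : ∀ {k : ℕ} (hk : (k : ℕ∞) ≤ n), X.cell k hk → Y.cell k hk
  app_bd : ∀ (ε : Bool) {k : ℕ} (hk : ((k + 1 : ℕ) : ℕ∞) ≤ n) (u : X.cell (k + 1) hk),
    Y.bd ε hk (app hk u) = app (natCast_le_of_succ_le hk) (X.bd ε hk u)

instance : Category (GlobSet.{u} n) where
  Hom := Hom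
  id X := { app := fun _ u => u, app_bd := fun _ _ _ _ => rfl }
  comp f g :=
    { app := fun hk u => g.app hk (f.app hk u)
      app_bd := fun ε _ hk u => by rw [g.app_bd, f.app_bd] }

@[ext]
theorem hom_ext {X Y : GlobSet.{u} n} {f g : X ⟶ Y}
    (h : ∀ {k : ℕ} (hk : (k : ℕ∞) ≤ n) (u : X.cell k hk), f.app hk u = g.app hk u) :
    f = g := by
  apply Hom.ext
  funext k hk u
  exact h hk u

@[simp]
theorem id_app (X : GlobSet.{u} n) {k : ℕ} (hk : (k : ℕ∞) ≤ n) (u : X.cell k hk) :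
    (𝟙 X : X ⟶ X).app hk u = u := rfl

@[simp]
theorem comp_app {X Y Z : GlobSet.{u} n} (f : X ⟶ Y) (g : Y ⟶ Z) {k : ℕ}
    (hk : (k : ℕ∞) ≤ n) (u : X.cell k hk) : (f ≫ g).app hk u = g.app hk (f.app hk u) := rfl

/-- Iterated source (`ε = false`) and target (`ε = true`): the operation
`∂ᵉᵢ = ∂ᵉᵢ ∘ ⋯ ∘ ∂ᵉₖ₋₁` from `k`-globes to `i`-globes, for `i ≤ k`. -/
def bdTo (X : GlobSet.{u} n) (ε : Bool) {i k : ℕ} (hik : i ≤ k) (hk : (k : ℕ∞) ≤ n)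
    (u : X.cell k hk) : X.cell i (natCast_le_of_le hik hk) :=
  Nat.leRec (n := i)
    (motive := fun m hm => ∀ hmn : (m : ℕ∞) ≤ n,
      X.cell m hmn → X.cell i (natCast_le_of_le hm hmn))
    (fun _ w => w) (fun _ _ f hmn w => f (natCast_le_of_succ_le hmn) (X.bd ε hmn w)) hik hk u

@[simp]
theorem bdTo_self (X : GlobSet.{u} n) (ε : Bool) {k : ℕ} (hk : (k : ℕ∞) ≤ n)
    (u : X.cell k hk) : X.bdTo ε le_rfl hk u = u := by
  simp [bdTo, Nat.leRec_self]

theorem bdTo_succ (X : GlobSet.{u} n) (ε : Bool) {i k : ℕ} (hik : i ≤ k)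
    (hk : ((k + 1 : ℕ) : ℕ∞) ≤ n) (u : X.cell (k + 1) hk) :
    X.bdTo ε (Nat.le_succ_of_le hik) hk u =
      X.bdTo ε hik (natCast_le_of_succ_le hk) (X.bd ε hk u) := by
  simp [bdTo, Nat.leRec_succ _ _ hik]

theorem Hom.app_bdTo {X Y : GlobSet.{u} n} (f : X.Hom Y) (ε : Bool) {i k : ℕ} (hik : i ≤ k)
    (hk : (k : ℕ∞) ≤ n) (u : X.cell k hk) :
    Y.bdTo ε hik hk (f.app hk u) = f.app (natCast_le_of_le hik hk) (X.bdTo ε hik hk u) := by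
  induction k, hik using Nat.le_induction with
  | base => simp
  | succ k hik ih => rw [bdTo_succ _ _ hik, bdTo_succ _ _ hik, f.app_bd, ih]

/-- Two `k`-globes `u, v` are `i`-composable (for `i < k`) when `∂⁺ᵢ u = ∂⁻ᵢ v`. -/
def Composable (X : GlobSet.{u} n) {i k : ℕ} (hik : i < k) (hk : (k : ℕ∞) ≤ n)
    (u v : X.cell k hk) : Prop :=
  X.bdTo true hik.le hk u = X.bdTo false hik.le hk v

theorem Hom.composable {X Y : GlobSet.{u} n} (f : X.Hom Y) {i k : ℕ} {hik : i < k}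
    {hk : (k : ℕ∞) ≤ n} {u v : X.cell k hk} (h : X.Composable hik hk u v) :
    Y.Composable hik hk (f.app hk u) (f.app hk v) := by
  unfold Composable at *
  rw [f.app_bdTo, f.app_bdTo, h]

/-- The truncation functor from `n`-globular sets to `m`-globular sets, for `m ≤ n`. -/
@[simps]
def trunc {m n : ℕ∞} (hmn : m ≤ n) : GlobSet.{u} n ⥤ GlobSet.{u} m where
  obj X :=
    { cell := fun k hk => X.cell k (hk.trans hmn)
      bd := fun ε _ hk u => X.bd ε (hk.trans hmn) u
      globular := fun ε _ hk u => X.globular ε (hk.trans hmn) u }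
  map f :=
    { app := fun hk u => f.app (hk.trans hmn) u
      app_bd := fun ε _ hk u => f.app_bd ε (hk.trans hmn) u }

theorem trunc_bdTo {m n : ℕ∞} (hmn : m ≤ n) (X : GlobSet.{u} n) (ε : Bool) {i k : ℕ}
    (hik : i ≤ k) (hk : (k : ℕ∞) ≤ m) (u : X.cell k (hk.trans hmn)) :
    ((trunc hmn).obj X).bdTo ε hik hk u = X.bdTo ε hik (hk.trans hmn) u := by
  induction k, hik using Nat.le_induction with
  | base => exact (bdTo_self _ _ _ _).trans (bdTo_self X _ _ _).symm
  | succ k hik ih =>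
    exact (bdTo_succ _ _ hik _ _).trans ((ih _ _).trans (bdTo_succ X _ hik _ _).symm)

theorem trunc_composable {m n : ℕ∞} (hmn : m ≤ n) (X : GlobSet.{u} n) {i k : ℕ}
    (hik : i < k) (hk : (k : ℕ∞) ≤ m) (u v : X.cell k (hk.trans hmn)) :
    ((trunc hmn).obj X).Composable hik hk u v ↔ X.Composable hik (hk.trans hmn) u v := by
  unfold Composable
  rw [trunc_bdTo, trunc_bdTo]
  rfl

/-- The inclusion functor from `m`-globular sets to `n`-globular sets. The inclusion of `X` has
the same `k`-globes as `X` for `k ≤ m` (a globe is a pair of a proof of `k ≤ m` and a `k`-globe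
of `X`), and no `k`-globe for `k > m`. -/
@[simps]
def incl (m n : ℕ∞) : GlobSet.{u} m ⥤ GlobSet.{u} n where
  obj X :=
    { cell := fun k _ => Σ' hk : (k : ℕ∞) ≤ m, X.cell k hk
      bd := fun ε _ _ u => ⟨natCast_le_of_succ_le u.1, X.bd ε u.1 u.2⟩
      globular := fun ε _ _ u => by
        dsimp only
        rw [X.globular ε u.1 u.2] }
  map f :=
    { app := fun _ u => ⟨u.1, f.app u.1 u.2⟩
      app_bd := fun ε _ _ u => by
        dsimp only
        rw [f.app_bd] }

/-- The unit `X ⟶ (incl X)|ₘ`; it is the canonical identification. -/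
@[simps]
def inclUnit {m n : ℕ∞} (hmn : m ≤ n) : 𝟭 (GlobSet.{u} m) ⟶ incl m n ⋙ trunc hmn where
  app X :=
    { app := fun hk u => ⟨hk, u⟩
      app_bd := fun _ _ _ _ => rfl }

/-- The counit: the canonical inclusion `incl (X|ₘ) ⟶ X`. -/
@[simps]
def inclCounit {m n : ℕ∞} (hmn : m ≤ n) : trunc hmn ⋙ incl m n ⟶ 𝟭 (GlobSet.{u} n) where
  app X :=
    { app := fun _ u => u.2
      app_bd := fun _ _ _ _ => rfl }

/-- The adjunction between inclusion and truncation. -/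
def inclAdj {m n : ℕ∞} (hmn : m ≤ n) : incl.{u} m n ⊣ trunc hmn :=
  Adjunction.mkOfUnitCounit { unit := inclUnit hmn, counit := inclCounit hmn }

/-- The canonical identification `incl X ⟶ incl (incl X)` of the inclusion from dimension `m`
to `n` with the composite of the inclusions from `m` to `l` and from `l` to `n`. -/
@[simps]
def inclIncl {m l : ℕ∞} (hml : m ≤ l) (n : ℕ∞) :
    incl.{u} m n ⟶ incl m l ⋙ incl l n where
  app X :=
    { app := fun _ u => ⟨u.1.trans hml, ⟨u.1, u.2⟩⟩
      app_bd := fun _ _ _ _ => rfl }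

/-- The canonical morphism `incl (X|ₘ) ⟶ incl X` of `n`-globular sets, for an `l`-globular set
`X` and `m ≤ l`. Identifying `incl (X|ₘ)` with `incl (incl (X|ₘ))`, it is the image under `incl`
of the counit `incl (X|ₘ) ⟶ X` between dimensions `m` and `l`. -/
def inclTruncHom {m l : ℕ∞} (hml : m ≤ l) (n : ℕ∞) :
    trunc.{u} hml ⋙ incl m n ⟶ incl l n where
  app X := (inclIncl hml n).app ((trunc hml).obj X) ≫ (incl l n).map ((inclAdj hml).counit.app X)

/-! ## Globular algebras -/

/-- The monad `Tᵐ = (T (incl -))|ₘ` on `m`-globular sets derived from a monad `T` on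
`n`-globular sets, for `m ≤ n`. -/
abbrev truncMonad {m n : ℕ∞} (T : CategoryTheory.Monad (GlobSet.{u} n)) (hmn : m ≤ n) :
    CategoryTheory.Monad (GlobSet.{u} m) :=
  pullMonad T (inclAdj hmn)

/-- The category `Algₘ` of globular algebras in dimension `m`, for a monad `T` on `n`-globular
sets and `m ≤ n`. -/
abbrev Alg {m n : ℕ∞} (T : CategoryTheory.Monad (GlobSet.{u} n)) (hmn : m ≤ n) :
    Type (u + 1) :=
  (truncMonad T hmn).Algebra

/-- The truncation functor `Algₙ ⥤ Algₘ`, where `Algₙ` is the category of `T`-algebras. It is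
induced by the monad functor `((-)|ₘ, (T ι)|ₘ)` where `ι` is the counit `incl (-|ₘ) ⟶ 1`. -/
def algTruncTop {m n : ℕ∞} (T : CategoryTheory.Monad (GlobSet.{u} n)) (hmn : m ≤ n) :
    T.Algebra ⥤ Alg T hmn :=
  (MndFunctor.ofAdjunction T (inclAdj hmn)).algebraFunctor

/-- The monad functor `((-)|ₘ, (Tˡ ι)|ₘ)` from `Tˡ` to `Tᵐ`, for `m ≤ l ≤ n`, where
`ι : incl (-|ₘ) ⟶ 1` is the counit between dimensions `m` and `l`. Since `Tˡ` is
`(T (incl -))|ₗ`, the transformation `(Tˡ ι)|ₘ` is `(T (incl ι))|ₘ`. -/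
@[simps F α]
def truncMndFunctor {m l n : ℕ∞} (T : CategoryTheory.Monad (GlobSet.{u} n)) (hml : m ≤ l)
    (hln : l ≤ n) :
    MndFunctor (truncMonad T hln) (truncMonad T (hml.trans hln)) where
  F := trunc hml
  α :=
    { app := fun X => (trunc (hml.trans hln)).map (T.map ((inclTruncHom hml n).app X))
      naturality := fun X Y f => by
        change (trunc (hml.trans hln)).map (T.map ((incl m n).map ((trunc hml).map f))) ≫
            (trunc (hml.trans hln)).map (T.map ((inclTruncHom hml n).app Y)) =
          (trunc (hml.trans hln)).map (T.map ((inclTruncHom hml n).app X)) ≫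
            (trunc (hml.trans hln)).map (T.map ((incl l n).map f))
        rw [← Functor.map_comp, ← Functor.map_comp, ← Functor.map_comp, ← Functor.map_comp]
        rfl }
  unit_α := fun X => by
    have h : (inclTruncHom hml n).app X ≫ T.η.app ((incl l n).obj X) =
        T.η.app _ ≫ T.map ((inclTruncHom hml n).app X) :=
      T.η.naturality ((inclTruncHom hml n).app X)
    change ((inclAdj (hml.trans hln)).unit.app ((trunc hml).obj X) ≫
        (trunc (hml.trans hln)).map (T.η.app ((incl m n).obj ((trunc hml).obj X)))) ≫
        (trunc (hml.trans hln)).map (T.map ((inclTruncHom hml n).app X)) = _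
    rw [Category.assoc, ← Functor.map_comp]
    exact congrArg (fun g => _ ≫ (trunc (hml.trans hln)).map g) h.symm
  mul_α := fun X => by
    have h := map_comp_mu_aux T ((inclTruncHom hml n).app X)
      ((inclAdj (hml.trans hln)).counit.app (T.obj ((incl m n).obj ((trunc hml).obj X))))
      ((incl m n).map ((trunc (hml.trans hln)).map (T.map ((inclTruncHom hml n).app X))))
      ((inclTruncHom hml n).app ((trunc hln).obj (T.obj ((incl l n).obj X))))
      ((inclAdj hln).counit.app (T.obj ((incl l n).obj X))) rfl
    exact congrArg (trunc (hml.trans hln)).map h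

/-- The truncation functor `Algₗ ⥤ Algₘ`, for `m ≤ l ≤ n`. -/
def algTrunc {m l n : ℕ∞} (T : CategoryTheory.Monad (GlobSet.{u} n)) (hml : m ≤ l)
    (hln : l ≤ n) : Alg T hln ⥤ Alg T (hml.trans hln) :=
  (truncMndFunctor T hml hln).algebraFunctor

end GlobSet

/-! ## Strict categories -/

/-- An `n`-globular set equipped with identity and composition operations, without axioms. -/
structure StrictCatData (n : ℕ∞) extends GlobSet.{u} n where
  /-- the identity operations `id : Cₖ → Cₖ₊₁` -/
  idt : ∀ {k : ℕ} (hk : ((k + 1 : ℕ) : ℕ∞) ≤ n),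
    cell k (natCast_le_of_succ_le hk) → cell (k + 1) hk
  /-- the compositions `u *ᵢ v` of `i`-composable `k`-globes, for `i < k` -/
  comp : ∀ {i k : ℕ} (hik : i < k) (hk : (k : ℕ∞) ≤ n) (u v : cell k hk),
    toGlobSet.Composable hik hk u v → cell k hk

/-- The iterated identity operation `Cᵢ → Cₖ`, for `i ≤ k`. -/
def StrictCatData.idTo {n : ℕ∞} (C : StrictCatData.{u} n) {i k : ℕ} (hik : i ≤ k)
    (hk : (k : ℕ∞) ≤ n) (u : C.cell i (natCast_le_of_le hik hk)) : C.cell k hk :=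
  Nat.leRec (n := i)
    (motive := fun m hm => ∀ hmn : (m : ℕ∞) ≤ n,
      C.cell i (natCast_le_of_le hm hmn) → C.cell m hmn)
    (fun _ w => w) (fun _ _ f hmn w => C.idt hmn (f (natCast_le_of_succ_le hmn) w)) hik hk u

@[simp]
theorem StrictCatData.idTo_self {n : ℕ∞} (C : StrictCatData.{u} n) {k : ℕ}
    (hk : (k : ℕ∞) ≤ n) (u : C.cell k hk) : C.idTo le_rfl hk u = u := by
  simp [idTo, Nat.leRec_self]

theorem StrictCatData.idTo_succ {n : ℕ∞} (C : StrictCatData.{u} n) {i k : ℕ} (hik : i ≤ k)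
    (hk : ((k + 1 : ℕ) : ℕ∞) ≤ n) (u : C.cell i (natCast_le_of_le hik
      (natCast_le_of_succ_le hk))) :
    C.idTo (Nat.le_succ_of_le hik) hk u =
      C.idt hk (C.idTo hik (natCast_le_of_succ_le hk) u) := by
  simp [idTo, Nat.leRec_succ _ _ hik]

/-- A strict `n`-category. The composability of the arguments of each composite that occurs in
the axioms is a consequence of the composability assumptions on the cells `u, v, …`, of the
globular equations and of the axioms on sources and targets (see
`StrictCat.composable_bd` and the facts that follow it); quantifying over its proofs is
therefore no restriction of the axioms. -/
structure StrictCat (n : ℕ∞) extends StrictCatData.{u} n where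
  /-- source and target of an identity -/
  bd_idt : ∀ (ε : Bool) {k : ℕ} (hk : ((k + 1 : ℕ) : ℕ∞) ≤ n)
    (u : cell k (natCast_le_of_succ_le hk)), bd ε hk (idt hk u) = u
  /-- source and target of `u *ᵢ v` in dimension `k + 1`, for `i < k` -/
  bd_comp : ∀ (ε : Bool) {i k : ℕ} (hik : i < k) (hk : ((k + 1 : ℕ) : ℕ∞) ≤ n)
    (u v : cell (k + 1) hk) (h : toGlobSet.Composable (Nat.lt_succ_of_lt hik) hk u v)
    (h' : toGlobSet.Composable hik (natCast_le_of_succ_le hk) (bd ε hk u) (bd ε hk v)),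
    bd ε hk (comp (Nat.lt_succ_of_lt hik) hk u v h) =
      comp hik (natCast_le_of_succ_le hk) (bd ε hk u) (bd ε hk v) h'
  /-- source of `u *ₖ v` in dimension `k + 1` -/
  src_comp : ∀ {k : ℕ} (hk : ((k + 1 : ℕ) : ℕ∞) ≤ n) (u v : cell (k + 1) hk)
    (h : toGlobSet.Composable (Nat.lt_succ_self k) hk u v),
    bd false hk (comp (Nat.lt_succ_self k) hk u v h) = bd false hk u
  /-- target of `u *ₖ v` in dimension `k + 1` -/
  tgt_comp : ∀ {k : ℕ} (hk : ((k + 1 : ℕ) : ℕ∞) ≤ n) (u v : cell (k + 1) hk)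
    (h : toGlobSet.Composable (Nat.lt_succ_self k) hk u v),
    bd true hk (comp (Nat.lt_succ_self k) hk u v h) = bd true hk v
  /-- left unitality -/
  id_comp : ∀ {i k : ℕ} (hik : i < k) (hk : (k : ℕ∞) ≤ n) (u : cell k hk)
    (h : toGlobSet.Composable hik hk
      (toStrictCatData.idTo hik.le hk (toGlobSet.bdTo false hik.le hk u)) u),
    comp hik hk (toStrictCatData.idTo hik.le hk (toGlobSet.bdTo false hik.le hk u)) u h = u
  /-- right unitality -/
  comp_id : ∀ {i k : ℕ} (hik : i < k) (hk : (k : ℕ∞) ≤ n) (u : cell k hk)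
    (h : toGlobSet.Composable hik hk u
      (toStrictCatData.idTo hik.le hk (toGlobSet.bdTo true hik.le hk u))),
    comp hik hk u (toStrictCatData.idTo hik.le hk (toGlobSet.bdTo true hik.le hk u)) h = u
  /-- associativity -/
  assoc : ∀ {i k : ℕ} (hik : i < k) (hk : (k : ℕ∞) ≤ n) (u v w : cell k hk)
    (huv : toGlobSet.Composable hik hk u v) (hvw : toGlobSet.Composable hik hk v w)
    (h : toGlobSet.Composable hik hk (comp hik hk u v huv) w)
    (h' : toGlobSet.Composable hik hk u (comp hik hk v w hvw)),
    comp hik hk (comp hik hk u v huv) w h = comp hik hk u (comp hik hk v w hvw) h'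
  /-- the identity of a composite -/
  idt_comp : ∀ {i k : ℕ} (hik : i < k) (hk : ((k + 1 : ℕ) : ℕ∞) ≤ n)
    (u v : cell k (natCast_le_of_succ_le hk))
    (h : toGlobSet.Composable hik (natCast_le_of_succ_le hk) u v)
    (h' : toGlobSet.Composable (Nat.lt_succ_of_lt hik) hk (idt hk u) (idt hk v)),
    idt hk (comp hik (natCast_le_of_succ_le hk) u v h) =
      comp (Nat.lt_succ_of_lt hik) hk (idt hk u) (idt hk v) h'
  /-- the exchange law, for `i < j < k` -/
  exchange : ∀ {i j k : ℕ} (hij : i < j) (hjk : j < k) (hk : (k : ℕ∞) ≤ n)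
    (u u' v v' : cell k hk)
    (huv : toGlobSet.Composable (hij.trans hjk) hk u v)
    (huv' : toGlobSet.Composable (hij.trans hjk) hk u' v')
    (hu : toGlobSet.Composable hjk hk u u') (hv : toGlobSet.Composable hjk hk v v')
    (h : toGlobSet.Composable hjk hk (comp (hij.trans hjk) hk u v huv)
      (comp (hij.trans hjk) hk u' v' huv'))
    (h' : toGlobSet.Composable (hij.trans hjk) hk (comp hjk hk u u' hu)
      (comp hjk hk v v' hv)),
    comp hjk hk (comp (hij.trans hjk) hk u v huv) (comp (hij.trans hjk) hk u' v' huv') h =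
      comp (hij.trans hjk) hk (comp hjk hk u u' hu) (comp hjk hk v v' hv) h'

namespace StrictCat

variable {n : ℕ∞}

/-! The composability conditions that occur in the axioms are always satisfied. -/

theorem _root_.GlobSet.bdTo_bd (X : GlobSet.{u} n) (ε δ : Bool) {i k : ℕ} (hik : i < k)
    (hk : ((k + 1 : ℕ) : ℕ∞) ≤ n) (u : X.cell (k + 1) hk) :
    X.bdTo ε hik.le (natCast_le_of_succ_le hk) (X.bd δ hk u) =
      X.bdTo ε (Nat.le_succ_of_le hik.le) hk u := by
  rw [X.bdTo_succ _ hik.le]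
  obtain ⟨k, rfl⟩ : ∃ l, k = l + 1 := ⟨k - 1, by omega⟩
  have h : i ≤ k := by omega
  rw [X.bdTo_succ _ h, X.bdTo_succ _ h]
  congr 1
  have := X.globular ε hk u
  cases ε <;> cases δ <;> simp_all

theorem _root_.GlobSet.bdTo_bdTo (X : GlobSet.{u} n) (ε δ : Bool) {i j k : ℕ} (hij : i < j)
    (hjk : j ≤ k) (hk : (k : ℕ∞) ≤ n) (u : X.cell k hk) :
    X.bdTo ε hij.le (natCast_le_of_le hjk hk) (X.bdTo δ hjk hk u) =
      X.bdTo ε (hij.le.trans hjk) hk u := by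
  induction k, hjk using Nat.le_induction with
  | base => simp
  | succ k hjk ih =>
    rw [X.bdTo_succ _ hjk, ih, X.bdTo_bd _ _ (by omega)]

theorem composable_bd (C : StrictCat.{u} n) (ε : Bool) {i k : ℕ} (hik : i < k)
    (hk : ((k + 1 : ℕ) : ℕ∞) ≤ n) {u v : C.cell (k + 1) hk}
    (h : C.Composable (Nat.lt_succ_of_lt hik) hk u v) :
    C.Composable hik (natCast_le_of_succ_le hk) (C.bd ε hk u) (C.bd ε hk v) := by
  unfold GlobSet.Composable at *
  rw [C.bdTo_bd _ _ hik, C.bdTo_bd _ _ hik, h]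

theorem bdTo_comp (C : StrictCat.{u} n) {i k : ℕ} (hik : i < k) (hk : (k : ℕ∞) ≤ n)
    (u v : C.cell k hk) (h : C.Composable hik hk u v) :
    C.bdTo false hik.le hk (C.comp hik hk u v h) = C.bdTo false hik.le hk u ∧
      C.bdTo true hik.le hk (C.comp hik hk u v h) = C.bdTo true hik.le hk v := by
  induction k, hik using Nat.le_induction with
  | base =>
    rw [C.bdTo_succ _ le_rfl, C.bdTo_succ _ le_rfl, C.bdTo_succ _ le_rfl, C.bdTo_succ _ le_rfl,
      C.src_comp, C.tgt_comp]
    exact ⟨rfl, rfl⟩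
  | succ k hik ih =>
    have hik' : i < k := hik
    rw [C.bdTo_succ _ hik'.le, C.bdTo_succ _ hik'.le, C.bdTo_succ _ hik'.le,
      C.bdTo_succ _ hik'.le, C.bd_comp _ hik' _ _ _ _ (C.composable_bd _ hik' _ h),
      C.bd_comp _ hik' _ _ _ _ (C.composable_bd _ hik' _ h)]
    exact ⟨(ih _ _ _ _).1, (ih _ _ _ _).2⟩

theorem bdTo_idTo (C : StrictCat.{u} n) (ε : Bool) {i k : ℕ} (hik : i ≤ k)
    (hk : (k : ℕ∞) ≤ n) (u : C.cell i (natCast_le_of_le hik hk)) :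
    C.bdTo ε hik hk (C.idTo hik hk u) = u := by
  induction k, hik using Nat.le_induction with
  | base => simp
  | succ k hik ih => rw [C.bdTo_succ _ hik, C.idTo_succ hik, C.bd_idt, ih]

theorem composable_idTo_left (C : StrictCat.{u} n) {i k : ℕ} (hik : i < k)
    (hk : (k : ℕ∞) ≤ n) (u : C.cell k hk) :
    C.Composable hik hk (C.idTo hik.le hk (C.bdTo false hik.le hk u)) u :=
  C.bdTo_idTo _ _ _ _

theorem composable_idTo_right (C : StrictCat.{u} n) {i k : ℕ} (hik : i < k)
    (hk : (k : ℕ∞) ≤ n) (u : C.cell k hk) :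
    C.Composable hik hk u (C.idTo hik.le hk (C.bdTo true hik.le hk u)) :=
  (C.bdTo_idTo _ _ _ _).symm

theorem composable_comp_left (C : StrictCat.{u} n) {i k : ℕ} (hik : i < k)
    (hk : (k : ℕ∞) ≤ n) {u v w : C.cell k hk} (huv : C.Composable hik hk u v)
    (hvw : C.Composable hik hk v w) : C.Composable hik hk (C.comp hik hk u v huv) w :=
  (C.bdTo_comp hik hk u v huv).2.trans hvw

theorem composable_comp_right (C : StrictCat.{u} n) {i k : ℕ} (hik : i < k)
    (hk : (k : ℕ∞) ≤ n) {u v w : C.cell k hk} (huv : C.Composable hik hk u v)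
    (hvw : C.Composable hik hk v w) : C.Composable hik hk u (C.comp hik hk v w hvw) :=
  huv.trans (C.bdTo_comp hik hk v w hvw).1.symm

theorem composable_idt (C : StrictCat.{u} n) {i k : ℕ} (hik : i < k)
    (hk : ((k + 1 : ℕ) : ℕ∞) ≤ n) {u v : C.cell k (natCast_le_of_succ_le hk)}
    (h : C.Composable hik (natCast_le_of_succ_le hk) u v) :
    C.Composable (Nat.lt_succ_of_lt hik) hk (C.idt hk u) (C.idt hk v) := by
  unfold GlobSet.Composable at *
  rw [C.bdTo_succ _ hik.le, C.bdTo_succ _ hik.le, C.bd_idt, C.bd_idt, h]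

theorem composable_bdTo (C : StrictCat.{u} n) (ε : Bool) {i j k : ℕ} (hij : i < j)
    (hjk : j ≤ k) (hk : (k : ℕ∞) ≤ n) {u v : C.cell k hk}
    (h : C.Composable (hij.trans_le hjk) hk u v) :
    C.Composable hij (natCast_le_of_le hjk hk) (C.bdTo ε hjk hk u) (C.bdTo ε hjk hk v) := by
  unfold GlobSet.Composable at *
  rw [C.bdTo_bdTo _ _ hij, C.bdTo_bdTo _ _ hij, h]

theorem bdTo_comp_of_lt (C : StrictCat.{u} n) (ε : Bool) {i j k : ℕ} (hij : i < j)
    (hjk : j ≤ k) (hk : (k : ℕ∞) ≤ n) (u v : C.cell k hk)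
    (h : C.Composable (hij.trans_le hjk) hk u v) :
    C.bdTo ε hjk hk (C.comp (hij.trans_le hjk) hk u v h) =
      C.comp hij (natCast_le_of_le hjk hk) (C.bdTo ε hjk hk u) (C.bdTo ε hjk hk v)
        (C.composable_bdTo ε hij hjk hk h) := by
  induction k, hjk using Nat.le_induction with
  | base => simp
  | succ k hjk ih =>
    have hik : i < k := hij.trans_le hjk
    rw [C.bdTo_succ _ hjk, C.bd_comp _ hik _ _ _ _ (C.composable_bd _ hik _ h), ih]
    simp only [C.bdTo_succ _ hjk]

theorem composable_exchange_source (C : StrictCat.{u} n) {i j k : ℕ} (hij : i < j)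
    (hjk : j < k) (hk : (k : ℕ∞) ≤ n) {u u' v v' : C.cell k hk}
    (huv : C.Composable (hij.trans hjk) hk u v) (hu : C.Composable hjk hk u u')
    (hv : C.Composable hjk hk v v') : C.Composable (hij.trans hjk) hk u' v' := by
  unfold GlobSet.Composable at *
  rw [← C.bdTo_bdTo true false hij hjk.le hk u', ← hu, C.bdTo_bdTo true true hij, huv,
    ← C.bdTo_bdTo false true hij hjk.le hk v, hv, C.bdTo_bdTo false false hij]

theorem composable_exchange_left (C : StrictCat.{u} n) {i j k : ℕ} (hij : i < j)
    (hjk : j < k) (hk : (k : ℕ∞) ≤ n) {u u' v v' : C.cell k hk}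
    (huv : C.Composable (hij.trans hjk) hk u v) (huv' : C.Composable (hij.trans hjk) hk u' v')
    (hu : C.Composable hjk hk u u') (hv : C.Composable hjk hk v v') :
    C.Composable hjk hk (C.comp (hij.trans hjk) hk u v huv)
      (C.comp (hij.trans hjk) hk u' v' huv') := by
  unfold GlobSet.Composable at hu hv ⊢
  rw [C.bdTo_comp_of_lt true hij hjk.le hk, C.bdTo_comp_of_lt false hij hjk.le hk]
  simp only [hu, hv]

theorem composable_exchange_right (C : StrictCat.{u} n) {i j k : ℕ} (hij : i < j)
    (hjk : j < k) (hk : (k : ℕ∞) ≤ n) {u u' v v' : C.cell k hk}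
    (huv : C.Composable (hij.trans hjk) hk u v) (hu : C.Composable hjk hk u u')
    (hv : C.Composable hjk hk v v') :
    C.Composable (hij.trans hjk) hk (C.comp hjk hk u u' hu) (C.comp hjk hk v v' hv) := by
  unfold GlobSet.Composable at huv ⊢
  rw [← C.bdTo_bdTo true false hij hjk.le hk (C.comp hjk hk u u' hu),
    (C.bdTo_comp hjk hk u u' hu).1, C.bdTo_bdTo true false hij, huv,
    ← C.bdTo_bdTo false false hij hjk.le hk (C.comp hjk hk v v' hv),
    (C.bdTo_comp hjk hk v v' hv).1, C.bdTo_bdTo false false hij]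

/-- Morphisms of strict `n`-categories, i.e. `n`-functors. -/
@[ext]
structure Hom (C D : StrictCat.{u} n) extends GlobSet.Hom C.toGlobSet D.toGlobSet where
  app_idt : ∀ {k : ℕ} (hk : ((k + 1 : ℕ) : ℕ∞) ≤ n) (u : C.cell k (natCast_le_of_succ_le hk)),
    app hk (C.idt hk u) = D.idt hk (app (natCast_le_of_succ_le hk) u)
  app_comp : ∀ {i k : ℕ} (hik : i < k) (hk : (k : ℕ∞) ≤ n) (u v : C.cell k hk)
    (h : C.Composable hik hk u v),
    app hk (C.comp hik hk u v h) =
      D.comp hik hk (app hk u) (app hk v) (toHom.composable h)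

instance : Category (StrictCat.{u} n) where
  Hom := Hom
  id C :=
    { toHom := 𝟙 C.toGlobSet
      app_idt := fun _ _ => rfl
      app_comp := fun _ _ _ _ _ => rfl }
  comp {C D E} f g :=
    { toHom := (show C.toGlobSet ⟶ D.toGlobSet from f.toHom) ≫
        (show D.toGlobSet ⟶ E.toGlobSet from g.toHom)
      app_idt := fun hk u => by
        change g.app hk (f.app hk _) = _
        rw [f.app_idt, g.app_idt]
        rfl
      app_comp := fun hik hk u v h => by
        change g.app hk (f.app hk _) = _
        rw [f.app_comp, g.app_comp]
        rfl }

/-- The forgetful functor from strict `n`-categories to `n`-globular sets. -/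
def forget (n : ℕ∞) : StrictCat.{u} n ⥤ GlobSet.{u} n where
  obj C := C.toGlobSet
  map f := f.toHom

/-- The data underlying the truncation of a strict `n`-category. -/
def _root_.StrictCatData.trunc {m n : ℕ∞} (hmn : m ≤ n) (C : StrictCatData.{u} n) :
    StrictCatData.{u} m where
  toGlobSet := (GlobSet.trunc hmn).obj C.toGlobSet
  idt := fun hk u => C.idt (hk.trans hmn) u
  comp := fun hik hk u v h =>
    C.comp hik (hk.trans hmn) u v ((GlobSet.trunc_composable hmn _ hik hk u v).mp h)

theorem _root_.StrictCatData.trunc_idTo {m n : ℕ∞} (hmn : m ≤ n) (C : StrictCatData.{u} n)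
    {i k : ℕ} (hik : i ≤ k) (hk : (k : ℕ∞) ≤ m)
    (u : C.cell i (natCast_le_of_le hik (hk.trans hmn))) :
    (C.trunc hmn).idTo hik hk u = C.idTo hik (hk.trans hmn) u := by
  induction k, hik using Nat.le_induction with
  | base => exact (StrictCatData.idTo_self _ _ _).trans (C.idTo_self _ _).symm
  | succ k hik ih =>
    exact (StrictCatData.idTo_succ _ hik _ _).trans
      ((congrArg _ (ih _ _)).trans (C.idTo_succ hik _ _).symm)

/-- The truncation functor from strict `n`-categories to strict `m`-categories, for `m ≤ n`. -/
def trunc {m n : ℕ∞} (hmn : m ≤ n) : StrictCat.{u} n ⥤ StrictCat.{u} m where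
  obj C :=
    { toStrictCatData := C.toStrictCatData.trunc hmn
      bd_idt := fun ε _ hk u => C.bd_idt ε (hk.trans hmn) u
      bd_comp := fun ε _ _ hik hk u v h h' => C.bd_comp ε hik (hk.trans hmn) u v
        ((GlobSet.trunc_composable hmn _ _ _ _ _).mp h)
        ((GlobSet.trunc_composable hmn _ _ _ _ _).mp h')
      src_comp := fun hk u v h => C.src_comp (hk.trans hmn) u v
        ((GlobSet.trunc_composable hmn _ _ _ _ _).mp h)
      tgt_comp := fun hk u v h => C.tgt_comp (hk.trans hmn) u v
        ((GlobSet.trunc_composable hmn _ _ _ _ _).mp h)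
      id_comp := fun {i k} hik hk u h => by
        have e : (C.toStrictCatData.trunc hmn).idTo hik.le hk
            (((GlobSet.trunc hmn).obj C.toGlobSet).bdTo false hik.le hk u) =
            C.idTo hik.le (hk.trans hmn) (C.bdTo false hik.le (hk.trans hmn) u) :=
          (StrictCatData.trunc_idTo hmn C.toStrictCatData hik.le hk _).trans
            (congrArg _ (GlobSet.trunc_bdTo hmn C.toGlobSet false hik.le hk u))
        have key : ∀ w, w = C.idTo hik.le (hk.trans hmn) (C.bdTo false hik.le (hk.trans hmn) u) →
            ∀ hw, C.comp hik (hk.trans hmn) w u hw = u := by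
          rintro w rfl hw
          exact C.id_comp hik (hk.trans hmn) u hw
        exact key _ e _
      comp_id := fun {i k} hik hk u h => by
        have e : (C.toStrictCatData.trunc hmn).idTo hik.le hk
            (((GlobSet.trunc hmn).obj C.toGlobSet).bdTo true hik.le hk u) =
            C.idTo hik.le (hk.trans hmn) (C.bdTo true hik.le (hk.trans hmn) u) :=
          (StrictCatData.trunc_idTo hmn C.toStrictCatData hik.le hk _).trans
            (congrArg _ (GlobSet.trunc_bdTo hmn C.toGlobSet true hik.le hk u))
        have key : ∀ w, w = C.idTo hik.le (hk.trans hmn) (C.bdTo true hik.le (hk.trans hmn) u) →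
            ∀ hw, C.comp hik (hk.trans hmn) u w hw = u := by
          rintro w rfl hw
          exact C.comp_id hik (hk.trans hmn) u hw
        exact key _ e _
      assoc := fun hik hk u v w huv hvw h h' => C.assoc hik (hk.trans hmn) u v w
        ((GlobSet.trunc_composable hmn _ _ _ _ _).mp huv)
        ((GlobSet.trunc_composable hmn _ _ _ _ _).mp hvw)
        ((GlobSet.trunc_composable hmn _ _ _ _ _).mp h)
        ((GlobSet.trunc_composable hmn _ _ _ _ _).mp h')
      idt_comp := fun hik hk u v h h' => C.idt_comp hik (hk.trans hmn) u v
        ((GlobSet.trunc_composable hmn _ _ _ _ _).mp h)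
        ((GlobSet.trunc_composable hmn _ _ _ _ _).mp h')
      exchange := fun hij hjk hk u u' v v' huv huv' hu hv h h' =>
        C.exchange hij hjk (hk.trans hmn) u u' v v'
          ((GlobSet.trunc_composable hmn _ _ _ _ _).mp huv)
          ((GlobSet.trunc_composable hmn _ _ _ _ _).mp huv')
          ((GlobSet.trunc_composable hmn _ _ _ _ _).mp hu)
          ((GlobSet.trunc_composable hmn _ _ _ _ _).mp hv)
          ((GlobSet.trunc_composable hmn _ _ _ _ _).mp h)
          ((GlobSet.trunc_composable hmn _ _ _ _ _).mp h') }
  map f :=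
    { toHom := (GlobSet.trunc hmn).map f.toHom
      app_idt := fun hk u => f.app_idt (hk.trans hmn) u
      app_comp := fun hik hk u v h => f.app_comp hik (hk.trans hmn) u v
        ((GlobSet.trunc_composable hmn _ _ _ _ _).mp h) }

end StrictCat

/-! ## Homomorphisms of categorical data -/

namespace StrictCatData

variable {n : ℕ∞}

/-! The forgetful functor $U_n$ is monadic for every $n\in\mathbb N\cup\{\omega\}$, and truncation
of strict categories has a right adjoint. These two facts carry the theorem.

The left adjoint of $U_n$ is built from formal composites. A formal composite is kept when it can be
evaluated in every strict category along every map of generators, and two of them are identified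
when all their values agree. The values then embed the quotient jointly in strict categories, so
every axiom is inherited (`StrictCatData.ofJointlyInjective`), and the universal property amounts to
the fact that functors commute with evaluation. Monadicity is Beck's theorem: given a $U_n$-split
pair, the operations of the middle category descend to the globular split coequalizer, and the
axioms descend along the retraction (`StrictCatData.ofRetract`).

For $m\le n$, the coskeleton is right adjoint to truncation $\mathbf{Cat}_n\to\mathbf{Cat}_m$, and
$(\mathrm{cosk}\,C)_{\le m}$ is isomorphic to $C$ as a globular set. Hence, for any $F\dashv U_n$,
$$\mathrm{Hom}((FX^{\uparrow n})_{\le m},C)\cong\mathrm{Hom}(FX^{\uparrow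
n},\mathrm{cosk}\,C)\cong\mathrm{Hom}(X^{\uparrow
n},U_n\mathrm{cosk}\,C)\cong\mathrm{Hom}(X,(U_n\mathrm{cosk}\,C)_{\le
m})\cong\mathrm{Hom}(X,U_mC),$$ so truncating the free category on $X^{\uparrow n}$ gives the free
$m$-category on $X$ (`truncAdj`). The monad of this adjunction has the same underlying functor as
$T^m$; the units agree, and so do the multiplications, because both underlie functors out of a free
category that agree on generators (`truncMul_eq`). The functor $H_m$ is the comparison functor of
this adjunction, read through the resulting identification of monads.

The equalities with truncation hold strictly. Both sides have the same underlying globular sets and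
maps, so only structure maps are to be compared. These underlie functors out of a truncated free
category, and the unit law makes them the identity on generators; so they coincide
(`eq_truncComparison_a`). -/

/-- Globular maps that preserve identities and compositions. -/
structure Hom (C D : StrictCatData.{u} n) extends GlobSet.Hom C.toGlobSet D.toGlobSet where
  app_idt : ∀ {k : ℕ} (hk : ((k + 1 : ℕ) : ℕ∞) ≤ n) (u : C.cell k (natCast_le_of_succ_le hk)),
    app hk (C.idt hk u) = D.idt hk (app (natCast_le_of_succ_le hk) u)
  app_comp : ∀ {i k : ℕ} (hik : i < k) (hk : (k : ℕ∞) ≤ n) (u v : C.cell k hk)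
    (h : C.Composable hik hk u v),
    app hk (C.comp hik hk u v h) =
      D.comp hik hk (app hk u) (app hk v) (toHom.composable h)

theorem Hom.app_idTo {C D : StrictCatData.{u} n} (f : Hom C D) {i k : ℕ} (hik : i ≤ k)
    (hk : (k : ℕ∞) ≤ n) (u : C.cell i (natCast_le_of_le hik hk)) :
    f.app hk (C.idTo hik hk u) = D.idTo hik hk (f.app (natCast_le_of_le hik hk) u) := by
  induction k, hik using Nat.le_induction with
  | base => simp
  | succ k hik ih => rw [C.idTo_succ hik, D.idTo_succ hik, f.app_idt, ih]

/-- A composite carries a proof of composability that depends on its arguments, which obstructs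
rewriting. This replaces the arguments and the proof together. -/
theorem comp_congr (C : StrictCatData.{u} n) {i k : ℕ} (hik : i < k) (hk : (k : ℕ∞) ≤ n)
    {u u' v v' : C.cell k hk} (hu : u = u') (hv : v = v') (h : C.Composable hik hk u v)
    (h' : C.Composable hik hk u' v') : C.comp hik hk u v h = C.comp hik hk u' v' h' := by
  subst hu hv
  rfl

/-- Categorical data with a jointly injective family of homomorphisms to strict categories
form a strict category. -/
def ofJointlyInjective (D : StrictCatData.{u} n) {ι : Sort*} (C : ι → StrictCat.{u} n)
    (φ : ∀ i, D.Hom (C i).toStrictCatData)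
    (inj : ∀ {k : ℕ} (hk : (k : ℕ∞) ≤ n) (u v : D.cell k hk),
      (∀ i, (φ i).app hk u = (φ i).app hk v) → u = v) : StrictCat.{u} n where
  toStrictCatData := D
  bd_idt ε _ hk u := inj _ _ _ fun i => by
    rw [← (φ i).app_bd, (φ i).app_idt, (C i).bd_idt]
  bd_comp ε _ _ hik hk u v h h' := inj _ _ _ fun i => by
    rw [← (φ i).app_bd, (φ i).app_comp, (φ i).app_comp,
      (C i).bd_comp ε hik hk _ _ _ ((C i).composable_bd ε hik hk ((φ i).composable h))]
    exact comp_congr _ _ _ ((φ i).app_bd _ _ _) ((φ i).app_bd _ _ _) _ _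
  src_comp hk u v h := inj _ _ _ fun i => by
    rw [← (φ i).app_bd, (φ i).app_comp, (C i).src_comp, (φ i).app_bd]
  tgt_comp hk u v h := inj _ _ _ fun i => by
    rw [← (φ i).app_bd, (φ i).app_comp, (C i).tgt_comp, (φ i).app_bd]
  id_comp hik hk u h := inj _ _ _ fun i => by
    rw [(φ i).app_comp]
    refine (comp_congr _ _ _ ?_ rfl _ ((C i).composable_idTo_left hik hk _)).trans
      ((C i).id_comp hik hk _ _)
    rw [(φ i).app_idTo, (φ i).app_bdTo]
  comp_id hik hk u h := inj _ _ _ fun i => by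
    rw [(φ i).app_comp]
    refine (comp_congr _ _ _ rfl ?_ _ ((C i).composable_idTo_right hik hk _)).trans
      ((C i).comp_id hik hk _ _)
    rw [(φ i).app_idTo, (φ i).app_bdTo]
  assoc hik hk u v w huv hvw h h' := inj _ _ _ fun i => by
    simp only [(φ i).app_comp]
    exact (C i).assoc hik hk _ _ _ _ _ _ _
  idt_comp hik hk u v h h' := inj _ _ _ fun i => by
    rw [(φ i).app_comp, (φ i).app_idt, (φ i).app_comp,
      (C i).idt_comp hik hk _ _ _ ((C i).composable_idt hik hk ((φ i).composable h))]
    exact comp_congr _ _ _ ((φ i).app_idt _ _).symm ((φ i).app_idt _ _).symm _ _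
  exchange hij hjk hk u u' v v' huv huv' hu hv h h' := inj _ _ _ fun i => by
    simp only [(φ i).app_comp]
    exact (C i).exchange hij hjk hk _ _ _ _ _ _ _ _ _ _

/-- Categorical data on a globular retract of a strict category, such that the retraction is
a homomorphism, form a strict category. -/
def ofRetract (D : StrictCatData.{u} n) (C : StrictCat.{u} n)
    (π : C.toStrictCatData.Hom D) (s : GlobSet.Hom D.toGlobSet C.toGlobSet)
    (hs : ∀ {k : ℕ} (hk : (k : ℕ∞) ≤ n) (u : D.cell k hk), π.app hk (s.app hk u) = u) :
    StrictCat.{u} n := by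
  -- As `π` is a homomorphism and `π ∘ s` is the identity, each operation of `D` is `π` of the
  -- operation of `C` on the images under `s`. Every axiom of `D` is thus the image under `π` of an
  -- axiom of `C`. The section need only be globular, which suffices to transport composability.
  have comp_eq : ∀ {i k : ℕ} (hik : i < k) (hk : (k : ℕ∞) ≤ n) (u v : D.cell k hk)
      (h : D.Composable hik hk u v), D.comp hik hk u v h =
        π.app hk (C.comp hik hk (s.app hk u) (s.app hk v) (s.composable h)) := by
    intro i k hik hk u v h
    rw [π.app_comp]
    exact comp_congr _ _ _ (hs _ _).symm (hs _ _).symm _ _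
  have idt_eq : ∀ {k : ℕ} (hk : ((k + 1 : ℕ) : ℕ∞) ≤ n)
      (u : D.cell k (natCast_le_of_succ_le hk)),
      D.idt hk u = π.app hk (C.idt hk (s.app _ u)) := by
    intro k hk u
    rw [π.app_idt, hs]
  have bd_eq : ∀ (ε : Bool) {k : ℕ} (hk : ((k + 1 : ℕ) : ℕ∞) ≤ n)
      (u : D.cell (k + 1) hk), D.bd ε hk u = π.app _ (C.bd ε hk (s.app hk u)) := by
    intro ε k hk u
    rw [s.app_bd, hs]
  exact
    { toStrictCatData := D
      bd_idt := fun ε _ hk u => by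
        rw [idt_eq, π.app_bd, C.bd_idt, hs]
      bd_comp := fun ε _ _ hik hk u v h h' => by
        rw [comp_eq, π.app_bd, C.bd_comp ε hik hk _ _ _
          (C.composable_bd ε hik hk (s.composable h)), comp_eq]
        exact congrArg _ (comp_congr _ _ _ (s.app_bd _ _ _) (s.app_bd _ _ _) _ _)
      src_comp := fun hk u v h => by
        rw [comp_eq, π.app_bd, C.src_comp, bd_eq]
      tgt_comp := fun hk u v h => by
        rw [comp_eq, π.app_bd, C.tgt_comp, bd_eq]
      id_comp := fun hik hk u h => by
        have e := congrArg (π.app hk) (C.id_comp hik hk (s.app hk u)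
          (C.composable_idTo_left hik hk _))
        rw [π.app_comp] at e
        refine (comp_congr _ _ _ ?_ (hs _ _).symm _ _).trans (e.trans (hs _ _))
        rw [π.app_idTo, s.app_bdTo, hs]
      comp_id := fun hik hk u h => by
        have e := congrArg (π.app hk) (C.comp_id hik hk (s.app hk u)
          (C.composable_idTo_right hik hk _))
        rw [π.app_comp] at e
        refine (comp_congr _ _ _ (hs _ _).symm ?_ _ _).trans (e.trans (hs _ _))
        rw [π.app_idTo, s.app_bdTo, hs]
      assoc := fun hik hk u v w huv hvw h h' => by
        have e := congrArg (π.app hk) (C.assoc hik hk (s.app hk u) (s.app hk v) (s.app hk w)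
          (s.composable huv) (s.composable hvw)
          (C.composable_comp_left hik hk (s.composable huv) (s.composable hvw))
          (C.composable_comp_right hik hk (s.composable huv) (s.composable hvw)))
        simpa only [π.app_comp, hs] using e
      idt_comp := fun hik hk u v h h' => by
        have e := congrArg (π.app hk) (C.idt_comp hik hk (s.app _ u) (s.app _ v)
          (s.composable h) (C.composable_idt hik hk (s.composable h)))
        simpa only [π.app_comp, π.app_idt, hs] using e
      exchange := fun hij hjk hk u u' v v' huv huv' hu hv h h' => by
        have e := congrArg (π.app hk) (C.exchange hij hjk hk (s.app _ u) (s.app _ u')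
          (s.app _ v) (s.app _ v') (s.composable huv) (s.composable huv') (s.composable hu)
          (s.composable hv)
          (C.composable_exchange_left hij hjk hk (s.composable huv) (s.composable huv')
            (s.composable hu) (s.composable hv))
          (C.composable_exchange_right hij hjk hk (s.composable huv)
            (s.composable hu) (s.composable hv)))
        simpa only [π.app_comp, hs] using e }

end StrictCatData

/-! ## Free strict categories -/

namespace GlobSet

variable {n : ℕ∞}

/-- Formal composites of cells of a globular set. -/
inductive Term (X : GlobSet.{u} n) : ∀ k : ℕ, (k : ℕ∞) ≤ n → Type u
  | gen {k : ℕ} (hk : (k : ℕ∞) ≤ n) (x : X.cell k hk) : Term X k hk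
  | bd (ε : Bool) {k : ℕ} (hk : ((k + 1 : ℕ) : ℕ∞) ≤ n) (t : Term X (k + 1) hk) :
      Term X k (natCast_le_of_succ_le hk)
  | idt {k : ℕ} (hk : ((k + 1 : ℕ) : ℕ∞) ≤ n) (t : Term X k (natCast_le_of_succ_le hk)) :
      Term X (k + 1) hk
  -- No composability is required: it would be an equality of boundaries in the free category, which
  -- is not yet available. It is imposed afterwards through `Term.Valid`. Boundaries are formal too,
  -- so that they need not be computed by recursion.
  | comp {i k : ℕ} (hik : i < k) (hk : (k : ℕ∞) ≤ n) (s t : Term X k hk) : Term X k hk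

/-! ### Evaluation and validity of formal composites -/

variable {X : GlobSet.{u} n}

namespace Term

open Classical in
/-- The partial evaluation of formal composites in a strict category. -/
noncomputable def eval (C : StrictCat.{u} n) (f : X ⟶ C.toGlobSet) :
    ∀ {k : ℕ} {hk : (k : ℕ∞) ≤ n}, Term X k hk → Option (C.cell k hk)
  | _, _, gen hk x => some (f.app hk x)
  | _, _, bd ε hk t => (eval C f t).map (C.bd ε hk)
  | _, _, idt hk t => (eval C f t).map (C.idt hk)
  | _, _, comp hik hk s t => (eval C f s).bind fun a => (eval C f t).bind fun b =>
      if h : C.Composable hik hk a b then some (C.comp hik hk a b h) else none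

theorem eval_comp_eq_some_iff {C : StrictCat.{u} n} {f : X ⟶ C.toGlobSet} {i k : ℕ}
    {hik : i < k} {hk : (k : ℕ∞) ≤ n} {s t : Term X k hk} {c : C.cell k hk} :
    eval C f (comp hik hk s t) = some c ↔ ∃ a b, ∃ h : C.Composable hik hk a b,
      eval C f s = some a ∧ eval C f t = some b ∧ C.comp hik hk a b h = c := by
  constructor
  · intro e
    simp only [eval, Option.bind_eq_some_iff] at e
    obtain ⟨a, ha, b, hb, e⟩ := e
    split_ifs at e with h
    exact ⟨a, b, h, ha, hb, Option.some.inj e⟩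
  · rintro ⟨a, b, h, ha, hb, rfl⟩
    simp [eval, ha, hb, h]

/-- Evaluation commutes with functors. -/
theorem eval_map {C D : StrictCat.{u} n} {f : X ⟶ C.toGlobSet} (g : C ⟶ D) {k : ℕ}
    {hk : (k : ℕ∞) ≤ n} (t : Term X k hk) {c : C.cell k hk} (hc : eval C f t = some c) :
    eval D (f ≫ (StrictCat.forget n).map g) t = some (g.app hk c) := by
  induction t with
  | gen hk x =>
    obtain rfl := Option.some.inj hc
    rfl
  | bd ε hk t ih =>
    simp only [eval, Option.map_eq_some_iff] at hc ⊢
    obtain ⟨a, ha, rfl⟩ := hc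
    exact ⟨_, ih ha, g.app_bd _ _ _⟩
  | idt hk t ih =>
    simp only [eval, Option.map_eq_some_iff] at hc ⊢
    obtain ⟨a, ha, rfl⟩ := hc
    exact ⟨_, ih ha, (g.app_idt _ _).symm⟩
  | comp hik hk s t ihs iht =>
    obtain ⟨a, b, h, ha, hb, rfl⟩ := eval_comp_eq_some_iff.mp hc
    exact eval_comp_eq_some_iff.mpr ⟨_, _, _, ihs ha, iht hb, (g.app_comp _ _ _ _ _).symm⟩

/-- A formal composite is valid when it can be evaluated in all strict categories. -/
def Valid {k : ℕ} {hk : (k : ℕ∞) ≤ n} (t : Term X k hk) : Prop :=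
  ∀ (C : StrictCat.{u} n) (f : X ⟶ C.toGlobSet), ∃ c, eval C f t = some c

end Term

/-! ### The free strict category as a quotient of the valid formal composites -/

variable (X)

/-- Valid formal composites are identified when they have the same values. -/
def termSetoid (k : ℕ) (hk : (k : ℕ∞) ≤ n) : Setoid {t : Term X k hk // t.Valid} where
  -- The relation quantifies over all strict categories, but it is a proposition, so the quotient
  -- stays in `Type u` and can itself serve as a test category.
  r s t := ∀ (C : StrictCat.{u} n) (f : X ⟶ C.toGlobSet), s.1.eval C f = t.1.eval C f
  iseqv := ⟨fun _ _ _ => rfl, fun h C f => (h C f).symm, fun h h' C f => (h C f).trans (h' C f)⟩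

/-- The cells of the free strict category. -/
def FreeCell (k : ℕ) (hk : (k : ℕ∞) ≤ n) : Type u := Quotient (X.termSetoid k hk)

namespace FreeCell

variable {X} {k : ℕ} {hk : (k : ℕ∞) ≤ n}

/-- The class of a valid formal composite. -/
def mk (t : Term X k hk) (ht : t.Valid) : X.FreeCell k hk := Quotient.mk _ ⟨t, ht⟩

/-- A formal composite that represents the given cell. -/
noncomputable def term (q : X.FreeCell k hk) : Term X k hk := (Quotient.out q).1

theorem term_valid (q : X.FreeCell k hk) : q.term.Valid := (Quotient.out q).2

/-- The value of a cell of the free strict category. -/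
noncomputable def value (C : StrictCat.{u} n) (f : X ⟶ C.toGlobSet) (q : X.FreeCell k hk) :
    C.cell k hk := (q.term_valid C f).choose

theorem eval_term (C : StrictCat.{u} n) (f : X ⟶ C.toGlobSet) (q : X.FreeCell k hk) :
    q.term.eval C f = some (q.value C f) := (q.term_valid C f).choose_spec

/-- Values are computed on the representative chosen by `Quotient.out`. The choice is harmless
because equivalent formal composites evaluate equally. -/
theorem eval_eq_value_mk (C : StrictCat.{u} n) (f : X ⟶ C.toGlobSet) (t : Term X k hk)
    (ht : t.Valid) : t.eval C f = some ((mk t ht).value C f) :=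
  ((Quotient.mk_out (s := X.termSetoid k hk) ⟨t, ht⟩) C f).symm.trans (eval_term C f (mk t ht))

theorem value_mk {C : StrictCat.{u} n} {f : X ⟶ C.toGlobSet} {t : Term X k hk}
    (ht : t.Valid) {c : C.cell k hk} (hc : t.eval C f = some c) :
    (mk t ht).value C f = c :=
  Option.some.inj ((eval_eq_value_mk C f t ht).symm.trans hc)

theorem mk_term (q : X.FreeCell k hk) : mk q.term q.term_valid = q := Quotient.out_eq q

/-- Values are jointly injective by the very definition of the equivalence relation. All equations
in the free category are checked through this. -/
theorem ext {q r : X.FreeCell k hk}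
    (h : ∀ (C : StrictCat.{u} n) (f : X ⟶ C.toGlobSet), q.value C f = r.value C f) : q = r := by
  rw [← q.mk_term, ← r.mk_term]
  refine Quotient.sound fun C f => ?_
  rw [eval_term, eval_term, h]

/-- The class of a generator. -/
def gen (hk : (k : ℕ∞) ≤ n) (x : X.cell k hk) : X.FreeCell k hk :=
  mk (Term.gen hk x) fun _ f => ⟨f.app hk x, rfl⟩

@[simp]
theorem value_gen (C : StrictCat.{u} n) (f : X ⟶ C.toGlobSet) (x : X.cell k hk) :
    (gen hk x).value C f = f.app hk x := value_mk _ rfl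

/-- Sources and targets of cells of the free strict category. -/
noncomputable def bd (ε : Bool) (hk : ((k + 1 : ℕ) : ℕ∞) ≤ n) (q : X.FreeCell (k + 1) hk) :
    X.FreeCell k (natCast_le_of_succ_le hk) :=
  mk (Term.bd ε hk q.term) fun C f => ⟨C.bd ε hk (q.value C f), by simp [Term.eval, eval_term]⟩

@[simp]
theorem value_bd (C : StrictCat.{u} n) (f : X ⟶ C.toGlobSet) (ε : Bool)
    (hk : ((k + 1 : ℕ) : ℕ∞) ≤ n) (q : X.FreeCell (k + 1) hk) :
    (bd ε hk q).value C f = C.bd ε hk (q.value C f) :=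
  value_mk _ (by simp [Term.eval, eval_term])

end FreeCell

/-- The globular set underlying the free strict category. -/
@[simps]
noncomputable def freeGlobSet : GlobSet.{u} n where
  cell := X.FreeCell
  bd ε _ hk q := FreeCell.bd ε hk q
  globular ε _ hk q := FreeCell.ext fun C f => by simp [C.globular ε hk]

/-- Evaluation in a strict category, as a map of globular sets. -/
noncomputable def freeValue (C : StrictCat.{u} n) (f : X ⟶ C.toGlobSet) :
    GlobSet.Hom X.freeGlobSet C.toGlobSet where
  app _ q := FreeCell.value C f q
  app_bd ε _ hk q := (FreeCell.value_bd C f ε hk q).symm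

namespace FreeCell

variable {X} {k : ℕ} {hk : (k : ℕ∞) ≤ n}

/-- Identities of the free strict category. -/
noncomputable def idt (hk : ((k + 1 : ℕ) : ℕ∞) ≤ n)
    (q : X.FreeCell k (natCast_le_of_succ_le hk)) : X.FreeCell (k + 1) hk :=
  mk (Term.idt hk q.term) fun C f => ⟨C.idt hk (q.value C f), by simp [Term.eval, eval_term]⟩

theorem value_idt (C : StrictCat.{u} n) (f : X ⟶ C.toGlobSet)
    (hk : ((k + 1 : ℕ) : ℕ∞) ≤ n) (q : X.FreeCell k (natCast_le_of_succ_le hk)) :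
    (idt hk q).value C f = C.idt hk (q.value C f) :=
  value_mk _ (by simp [Term.eval, eval_term])

theorem eval_comp_term (C : StrictCat.{u} n) (f : X ⟶ C.toGlobSet) {i : ℕ} (hik : i < k)
    (q r : X.FreeCell k hk) (h : X.freeGlobSet.Composable hik hk q r) :
    (Term.comp hik hk q.term r.term).eval C f =
      some (C.comp hik hk (q.value C f) (r.value C f) ((X.freeValue C f).composable h)) :=
  Term.eval_comp_eq_some_iff.mpr
    ⟨_, _, (X.freeValue C f).composable h, eval_term C f q, eval_term C f r, rfl⟩

/-- Compositions of the free strict category. -/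
noncomputable def comp {i : ℕ} (hik : i < k) (hk : (k : ℕ∞) ≤ n) (q r : X.FreeCell k hk)
    (h : X.freeGlobSet.Composable hik hk q r) : X.FreeCell k hk :=
  mk (Term.comp hik hk q.term r.term) fun C f => ⟨_, eval_comp_term C f hik q r h⟩

theorem value_comp (C : StrictCat.{u} n) (f : X ⟶ C.toGlobSet) {i : ℕ} (hik : i < k)
    (q r : X.FreeCell k hk) (h : X.freeGlobSet.Composable hik hk q r) :
    (comp hik hk q r h).value C f =
      C.comp hik hk (q.value C f) (r.value C f) ((X.freeValue C f).composable h) :=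
  value_mk _ (eval_comp_term C f hik q r h)

end FreeCell

/-- The operations of the free strict category. -/
noncomputable def freeData : StrictCatData.{u} n where
  toGlobSet := X.freeGlobSet
  idt hk q := FreeCell.idt hk q
  comp hik hk q r h := FreeCell.comp hik hk q r h

/-- Evaluation in a strict category, as a homomorphism. -/
noncomputable def freeDataValue (C : StrictCat.{u} n) (f : X ⟶ C.toGlobSet) :
    X.freeData.Hom C.toStrictCatData where
  toHom := X.freeValue C f
  app_idt hk q := FreeCell.value_idt C f hk q
  app_comp hik _ q r h := FreeCell.value_comp C f hik q r h

/-- The free strict category on a globular set. -/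
noncomputable def free : StrictCat.{u} n :=
  X.freeData.ofJointlyInjective (ι := Σ C : StrictCat.{u} n, X ⟶ C.toGlobSet) (fun i => i.1)
    (fun i => X.freeDataValue i.1 i.2) fun _ _ _ h => FreeCell.ext fun C f => h ⟨C, f⟩

/-- The inclusion of generators. -/
noncomputable def freeUnit : X ⟶ X.free.toGlobSet where
  app hk x := FreeCell.gen hk x
  app_bd ε _ hk x := FreeCell.ext fun C f =>
    (FreeCell.value_bd C f ε hk _).trans (by simp [f.app_bd])

/-- The extension of a map of globular sets to the free strict category. -/
noncomputable def freeLift (C : StrictCat.{u} n) (f : X ⟶ C.toGlobSet) : X.free ⟶ C where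
  toHom := X.freeValue C f
  app_idt := (X.freeDataValue C f).app_idt
  app_comp := (X.freeDataValue C f).app_comp

theorem freeUnit_lift (C : StrictCat.{u} n) (f : X ⟶ C.toGlobSet) :
    X.freeUnit ≫ (StrictCat.forget n).map (X.freeLift C f) = f := by
  ext k hk x
  exact FreeCell.value_gen C f x

/-- The free category is one of the categories in which cells are evaluated, and there each cell
evaluates to itself: pushing this value along any `freeLift` gives the value in the target, since
functors commute with evaluation. This says that the generators generate, and uniqueness of
extensions follows. -/
theorem value_freeUnit {k : ℕ} {hk : (k : ℕ∞) ≤ n} (q : X.FreeCell k hk) :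
    q.value X.free X.freeUnit = q :=
  FreeCell.ext fun C f => by
    have h := Term.eval_map (X.freeLift C f) q.term (FreeCell.eval_term X.free X.freeUnit q)
    exact Option.some.inj (h.symm.trans ((congrArg (fun f => Term.eval C f q.term)
      (X.freeUnit_lift C f)).trans (FreeCell.eval_term C f q)))

theorem freeLift_unique (C : StrictCat.{u} n) (f : X ⟶ C.toGlobSet) (g : X.free ⟶ C)
    (hg : X.freeUnit ≫ (StrictCat.forget n).map g = f) : g = X.freeLift C f := by
  subst hg
  apply StrictCat.Hom.ext
  funext k hk q
  have h := Term.eval_map g (FreeCell.term q) (FreeCell.eval_term X.free X.freeUnit q)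
  exact (congrArg (g.app hk) (X.value_freeUnit q)).symm.trans
    (Option.some.inj (h.symm.trans (FreeCell.eval_term C _ q)))

end GlobSet

theorem StrictCat.forget_isRightAdjoint (n : ℕ∞) : (StrictCat.forget.{u} n).IsRightAdjoint :=
  (Adjunction.adjunctionOfEquivLeft (G := StrictCat.forget.{u} n) (F_obj := GlobSet.free)
    (fun X C =>
      { toFun := fun g => X.freeUnit ≫ (StrictCat.forget n).map g
        invFun := fun f => X.freeLift C f
        left_inv := fun g => (X.freeLift_unique C _ g rfl).symm
        right_inv := fun f => X.freeUnit_lift C f })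
    fun _ _ _ _ _ => rfl).isRightAdjoint

/-! ## Monadicity -/

open Limits

namespace StrictCat

variable {n : ℕ∞}

theorem Hom.ext_toHom {C D : StrictCat.{u} n} {f g : C ⟶ D}
    (h : (forget n).map f = (forget n).map g) : f = g := by
  apply Hom.ext
  funext k hk x
  exact congrArg (fun a : GlobSet.Hom C.toGlobSet D.toGlobSet => a.app hk x) h

instance : (forget.{u} n).ReflectsIsomorphisms where
  reflects {C D} f _ := by
    have h1 : ∀ {k : ℕ} (hk : (k : ℕ∞) ≤ n) (x : C.cell k hk),
        (inv ((forget n).map f)).app hk (f.app hk x) = x := fun hk x =>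
      congrArg (fun a : (forget n).obj C ⟶ (forget n).obj C => a.app hk x)
        (IsIso.hom_inv_id ((forget n).map f))
    have h2 : ∀ {k : ℕ} (hk : (k : ℕ∞) ≤ n) (x : D.cell k hk),
        f.app hk ((inv ((forget n).map f)).app hk x) = x := fun hk x =>
      congrArg (fun a : (forget n).obj D ⟶ (forget n).obj D => a.app hk x)
        (IsIso.inv_hom_id ((forget n).map f))
    let g : D ⟶ C :=
      { toHom := inv ((forget n).map f)
        app_idt := fun hk u => by
          refine (congrArg _ ?_).trans (h1 hk _)
          rw [f.app_idt]
          exact congrArg _ (h2 _ u).symm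
        app_comp := fun hik hk u v h => by
          refine (congrArg _ ?_).trans (h1 hk _)
          rw [f.app_comp]
          exact StrictCatData.comp_congr _ _ _ (h2 _ u).symm (h2 _ v).symm _ _ }
    exact ⟨g, Hom.ext_toHom (IsIso.hom_inv_id ((forget n).map f)),
      Hom.ext_toHom (IsIso.inv_hom_id ((forget n).map f))⟩

/-! ### Coequalizers of pairs that split in globular sets -/

section SplitCoequalizer

variable {A B : StrictCat.{u} n} {f g : A ⟶ B} {Q : GlobSet.{u} n} {π : (forget n).obj B ⟶ Q}
  (σ : IsSplitCoequalizer ((forget n).map f) ((forget n).map g) π)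

include σ

theorem π_section {k : ℕ} (hk : (k : ℕ∞) ≤ n) (q : Q.cell k hk) :
    π.app hk (σ.rightSection.app hk q) = q :=
  congrArg (fun a : Q ⟶ Q => a.app hk q) σ.rightSection_π

/-- The operations on the target of a split coequalizer of strict categories. -/
def splitCoequalizerData : StrictCatData.{u} n where
  toGlobSet := Q
  idt hk q := π.app hk (B.idt hk (σ.rightSection.app _ q))
  comp hik hk q r h := π.app hk (B.comp hik hk (σ.rightSection.app hk q)
    (σ.rightSection.app hk r) (σ.rightSection.composable h))

theorem π_left_eq_right {k : ℕ} (hk : (k : ℕ∞) ≤ n) (x : A.cell k hk) :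
    π.app hk (f.app hk x) = π.app hk (g.app hk x) :=
  congrArg (fun a : (forget n).obj A ⟶ Q => a.app hk x) σ.condition

theorem left_section {k : ℕ} (hk : (k : ℕ∞) ≤ n) (x : B.cell k hk) :
    g.app hk (σ.leftSection.app hk x) = x :=
  congrArg (fun a : (forget n).obj B ⟶ (forget n).obj B => a.app hk x) σ.leftSection_bottom

theorem top_section {k : ℕ} (hk : (k : ℕ∞) ≤ n) (x : B.cell k hk) :
    f.app hk (σ.leftSection.app hk x) = σ.rightSection.app hk (π.app hk x) :=
  congrArg (fun a : (forget n).obj B ⟶ (forget n).obj B => a.app hk x) σ.leftSection_top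

/-- A split coequalizer of strict categories is a homomorphism. -/
def splitCoequalizerHom : B.toStrictCatData.Hom (splitCoequalizerData σ) where
  toHom := π
  app_idt hk u := by
    -- Write $t$ and $s$ for the left and right sections, so that $gt=1$ and $ft=s\pi$. Then
    -- $\pi(\mathrm{id}_u)=\pi(\mathrm{id}_{gtu})=\pi g(\mathrm{id}_{tu})=\pi
    -- f(\mathrm{id}_{tu})=\pi(\mathrm{id}_{s\pi u})$, which is the identity of $\pi u$ by
    -- definition. Compositions are treated in the same way.
    have h := ((congrArg (π.app hk) (f.app_idt hk (σ.leftSection.app _ u))).symm.trans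
      (π_left_eq_right σ hk _)).trans (congrArg (π.app hk) (g.app_idt hk _))
    refine (congrArg (fun x => π.app hk (B.idt hk x)) (left_section σ _ u)).symm.trans
      (h.symm.trans ?_)
    exact congrArg (fun x => π.app hk (B.idt hk x)) (top_section σ _ u)
  app_comp hik hk u v h := by
    have e := ((congrArg (π.app hk) (f.app_comp hik hk _ _ (σ.leftSection.composable h))).symm.trans
      (π_left_eq_right σ hk _)).trans (congrArg (π.app hk) (g.app_comp hik hk _ _ _))
    refine (congrArg (π.app hk) ?_).trans (e.symm.trans (congrArg (π.app hk) ?_))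
    · exact StrictCatData.comp_congr _ _ _ (left_section σ _ u).symm (left_section σ _ v).symm _ _
    · exact StrictCatData.comp_congr _ _ _ (top_section σ _ u) (top_section σ _ v) _ _

/-- The strict category structure on the target of a split coequalizer. -/
def splitCoequalizer : StrictCat.{u} n :=
  (splitCoequalizerData σ).ofRetract B (splitCoequalizerHom σ) σ.rightSection (π_section σ)

/-- The split coequalizer as a functor. -/
def splitCoequalizerπ : B ⟶ splitCoequalizer σ where
  toHom := π
  app_idt := (splitCoequalizerHom σ).app_idt
  app_comp := (splitCoequalizerHom σ).app_comp

theorem splitCoequalizer_condition :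
    f ≫ splitCoequalizerπ σ = g ≫ splitCoequalizerπ σ :=
  Hom.ext_toHom σ.condition

/-- The functor from a split coequalizer that is induced by a functor. -/
def splitCoequalizerDesc {C : StrictCat.{u} n} (h : B ⟶ C) (w : f ≫ h = g ≫ h) :
    splitCoequalizer σ ⟶ C :=
  -- With the sections $t$ and $s$ as above, $hs\pi=hft=hgt=h$. Since the operations of the quotient
  -- are $\pi$ of operations of `B`, this makes $hs$ a functor.
  have hs : ∀ {k : ℕ} (hk : (k : ℕ∞) ≤ n) (x : B.cell k hk),
      h.app hk (σ.rightSection.app hk (π.app hk x)) = h.app hk x := fun hk x => by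
    have e := congrArg (fun a : A ⟶ C => a.app hk (σ.leftSection.app hk x)) w
    exact (congrArg (h.app hk) (top_section σ hk x)).symm.trans
      (e.trans (congrArg (h.app hk) (left_section σ hk x)))
  { toHom := σ.rightSection ≫ (forget n).map h
    app_idt := fun hk u => (hs hk _).trans (h.app_idt hk _)
    app_comp := fun hik hk u v hc => (hs hk _).trans (h.app_comp hik hk _ _ _) }

/-- The split coequalizer is a coequalizer of strict categories. -/
def splitCoequalizerIsColimit :
    IsColimit (Cofork.ofπ (splitCoequalizerπ σ) (splitCoequalizer_condition σ)) :=
  Cofork.IsColimit.mk _ (fun s => splitCoequalizerDesc σ s.π s.condition)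
    (fun s => Hom.ext_toHom <| by
      have e := congrArg (forget n).map s.condition
      simp only [Functor.map_comp] at e
      change π ≫ σ.rightSection ≫ (forget n).map s.π = (forget n).map s.π
      rw [← σ.leftSection_top_assoc, e, σ.leftSection_bottom_assoc])
    (fun s m hm => Hom.ext_toHom <| by
      change (forget n).map m = σ.rightSection ≫ (forget n).map s.π
      rw [← hm, Functor.map_comp]
      exact (σ.rightSection_π_assoc ((forget n).map m)).symm)

end SplitCoequalizer

instance : Monad.HasCoequalizerOfIsSplitPair (forget.{u} n) where
  out f g _ := ⟨⟨⟨_, splitCoequalizerIsColimit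
    (HasSplitCoequalizer.isSplitCoequalizer ((forget n).map f) ((forget n).map g))⟩⟩⟩

/-- The coequalizer constructed in strict categories lies over the given split one, which is a
coequalizer because it is split. -/
instance : Monad.PreservesColimitOfIsSplitPair (forget.{u} n) where
  out f g _ := by
    let σ := HasSplitCoequalizer.isSplitCoequalizer ((forget n).map f) ((forget n).map g)
    exact preservesColimit_of_preserves_colimit_cocone (splitCoequalizerIsColimit σ)
      ((isColimitMapCoconeCoforkEquiv (forget n) (splitCoequalizer_condition σ)).symm
        σ.isCoequalizer)

/-- The forgetful functor from strict categories to globular sets is monadic. -/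
theorem comparison_isEquivalence {F : GlobSet.{u} n ⥤ StrictCat.{u} n} (adj : F ⊣ forget n) :
    (Monad.comparison adj).IsEquivalence :=
  (Monad.monadicOfHasPreservesGSplitCoequalizersOfReflectsIsomorphisms adj).eqv

end StrictCat

/-! ## Coskeletal strict categories -/

namespace StrictCat

variable {m : ℕ∞} (C : StrictCat.{u} m)

/-- A cell of dimension `j` of the coskeleton of `C`: the table of the iterated sources and
targets, in dimensions `l ≤ j` with `l ≤ m`, of a cell of dimension `j`. -/
@[ext]
structure CoskCell (j : ℕ) where
  /-- the entries of the table -/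
  val : ∀ (_ε : Bool) {l : ℕ} (_hj : l ≤ j) (hl : (l : ℕ∞) ≤ m), C.cell l hl
  bd_entry : ∀ (δ ε : Bool) {l : ℕ} (hj : l + 1 ≤ j) (hl : ((l + 1 : ℕ) : ℕ∞) ≤ m),
    C.bd δ hl (val ε hj hl) = val δ (Nat.le_of_succ_le hj) (natCast_le_of_succ_le hl)
  val_top : ∀ (ε δ : Bool) (hl : (j : ℕ∞) ≤ m), val ε le_rfl hl = val δ le_rfl hl

namespace CoskCell

variable {C}

/-- By the globular identities only the last sign of an iterated boundary counts, so the sign of the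
initial entry disappears. -/
theorem bdTo_val {j : ℕ} (x : C.CoskCell j) (δ ε : Bool) {i l : ℕ} (hil : i < l) (hj : l ≤ j)
    (hl : (l : ℕ∞) ≤ m) :
    C.bdTo δ hil.le hl (x.val ε hj hl) = x.val δ (hil.le.trans hj) (natCast_le_of_le hil.le hl) := by
  induction l, hil using Nat.le_induction generalizing ε with
  | base => rw [C.bdTo_succ _ le_rfl, x.bd_entry, C.bdTo_self]
  | succ l hil ih => rw [C.bdTo_succ _ (Nat.le_of_succ_le hil), x.bd_entry, ih]

/-- Sources and targets in the coskeleton. -/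
@[simps]
def bd (ε : Bool) {j : ℕ} (x : C.CoskCell (j + 1)) : C.CoskCell j where
  -- Row `j` becomes the top row, where both signs must agree, so it is filled with the chosen side.
  -- If `j > m` this row is absent and the table is unchanged: above dimension `m + 1` every cell
  -- has equal source and target.
  val δ l hj hl := x.val (if l = j then ε else δ) (Nat.le_succ_of_le hj) hl
  bd_entry δ δ' l hj hl := by
    rw [x.bd_entry, if_neg (by omega)]
  val_top δ δ' hl := by simp

/-- Identities in the coskeleton. -/
def idt {j : ℕ} (x : C.CoskCell j) : C.CoskCell (j + 1) where
  val ε l hj hl := match l, hj, hl with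
    | 0, _, hl => x.val ε (Nat.zero_le j) hl
    -- In the remaining case `l = j`; using row `l` rather than row `j` avoids a transport along
    -- this equality.
    | l + 1, hj, hl => if h : l + 1 ≤ j then x.val ε h hl else
        C.idt hl (x.val ε (Nat.le_of_succ_le_succ hj) (natCast_le_of_succ_le hl))
  bd_entry δ ε l hj hl := by
    cases l with
    | zero =>
      dsimp only
      split_ifs with h
      · exact x.bd_entry _ _ _ _
      · rw [C.bd_idt]
        obtain rfl : j = 0 := by omega
        exact x.val_top _ _ _
    | succ l =>
      have hlj : l + 1 ≤ j := by omega
      dsimp only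
      rw [dif_pos hlj]
      split_ifs with h
      · exact x.bd_entry _ _ _ _
      · rw [C.bd_idt]
        obtain rfl : j = l + 1 := by omega
        exact x.val_top _ _ _
  val_top ε δ hl := by
    dsimp only
    rw [dif_neg (by omega), dif_neg (by omega), x.val_top ε δ]

theorem idt_val_of_le {j : ℕ} (x : C.CoskCell j) (ε : Bool) {l : ℕ} (hj : l ≤ j)
    (hj' : l ≤ j + 1) (hl : (l : ℕ∞) ≤ m) : x.idt.val ε hj' hl = x.val ε hj hl := by
  cases l with
  | zero => rfl
  | succ l => exact dif_pos hj

theorem idt_val_top {j : ℕ} (x : C.CoskCell j) (ε : Bool) (hl : ((j + 1 : ℕ) : ℕ∞) ≤ m) :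
    x.idt.val ε le_rfl hl = C.idt hl (x.val ε le_rfl (natCast_le_of_succ_le hl)) :=
  dif_neg (by omega)

end CoskCell

variable (n : ℕ∞)

/-- The globular set underlying the coskeleton. -/
abbrev coskGlobSet : GlobSet.{u} n where
  cell j _ := C.CoskCell j
  bd ε _ _ x := x.bd ε
  globular ε j _ x := by
    ext δ l hj hl
    simp only [CoskCell.bd_val]
    simp only [show l ≠ j + 1 by omega, if_false]

variable {n}

/-- An iterated boundary drops the rows above `i`, overwrites row `i` by its `ε` entry and keeps the
lower rows. -/
theorem coskGlobSet_bdTo_val (ε : Bool) {i j : ℕ} (hij : i ≤ j) (hj : (j : ℕ∞) ≤ n)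
    (x : C.CoskCell j) (δ : Bool) {l : ℕ} (hli : l ≤ i) (hl : (l : ℕ∞) ≤ m) :
    ((C.coskGlobSet n).bdTo ε hij hj x : C.CoskCell i).val δ hli hl =
      x.val (if l = i then ε else δ) (hli.trans hij) hl := by
  induction j, hij using Nat.le_induction with
  | base =>
    rw [GlobSet.bdTo_self]
    split_ifs with h
    · subst h
      exact x.val_top _ _ _
    · rfl
  | succ j hij ih =>
    rw [GlobSet.bdTo_succ _ _ hij]
    refine (ih _ _).trans ?_
    simp only [CoskCell.bd_val]
    congr 1
    split_ifs <;> first | rfl | omega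

/-- The rows below `i` agree with both signs because the two boundaries are equal as whole tables.
The condition on row `i` is vacuous when `i > m`. -/
theorem coskGlobSet_composable_iff {i j : ℕ} (hij : i < j) (hj : (j : ℕ∞) ≤ n)
    (x y : C.CoskCell j) : (C.coskGlobSet n).Composable hij hj x y ↔
      (∀ hi : (i : ℕ∞) ≤ m, x.val true hij.le hi = y.val false hij.le hi) ∧
      ∀ (δ : Bool) {l : ℕ} (hli : l < i) (hl : (l : ℕ∞) ≤ m),
        x.val δ (hli.le.trans hij.le) hl = y.val δ (hli.le.trans hij.le) hl := by
  constructor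
  · intro h
    constructor
    · intro hi
      have e := congrArg (fun z : C.CoskCell i => z.val true le_rfl hi) h
      simpa only [coskGlobSet_bdTo_val, if_true] using e
    · intro δ l hli hl
      have e := congrArg (fun z : C.CoskCell i => z.val δ hli.le hl) h
      simpa only [coskGlobSet_bdTo_val, hli.ne, if_false] using e
  · rintro ⟨h1, h2⟩
    refine CoskCell.ext ?_
    funext δ l hli hl
    rw [coskGlobSet_bdTo_val, coskGlobSet_bdTo_val]
    rcases hli.eq_or_lt with rfl | hli
    · simpa using h1 hl
    · simpa [hli.ne] using h2 δ hli hl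

theorem composable_coskVal {i j : ℕ} {hij : i < j} {hj : (j : ℕ∞) ≤ n}
    {x y : C.CoskCell j} (h : (C.coskGlobSet n).Composable hij hj x y) (ε : Bool) {l : ℕ}
    (hil : i < l) (hlj : l ≤ j) (hl : (l : ℕ∞) ≤ m) :
    C.Composable hil hl (x.val ε hlj hl) (y.val ε hlj hl) := by
  unfold GlobSet.Composable
  rw [x.bdTo_val _ _ hil, y.bdTo_val _ _ hil]
  exact ((C.coskGlobSet_composable_iff _ _ _ _).mp h).1 _

/-- Compositions in the coskeleton. -/
def coskComp {i j : ℕ} (hij : i < j) (hj : (j : ℕ∞) ≤ n) (x y : C.CoskCell j)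
    (h : (C.coskGlobSet n).Composable hij hj x y) : C.CoskCell j where
  -- Rows above `i` are composed in `C`. Row `i` takes its source from `x` and its target from `y`;
  -- in lower rows `x` and `y` agree, so the same formula applies.
  val ε l hlj hl := if hil : i < l then
      C.comp hil hl (x.val ε hlj hl) (y.val ε hlj hl) (C.composable_coskVal h ε hil hlj hl)
    else bif ε then y.val true hlj hl else x.val false hlj hl
  bd_entry δ ε l hlj hl := by
    have h' := (C.coskGlobSet_composable_iff _ _ _ _).mp h
    rcases lt_trichotomy i l with hil | rfl | hil
    · rw [dif_pos (by omega), dif_pos hil, C.bd_comp _ hil _ _ _ _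
        (C.composable_bd _ hil _ (C.composable_coskVal h ε _ hlj hl))]
      exact StrictCatData.comp_congr _ _ _ (x.bd_entry _ _ _ _) (y.bd_entry _ _ _ _) _ _
    · rw [dif_pos (Nat.lt_succ_self _), dif_neg (lt_irrefl _)]
      cases δ
      · exact (C.src_comp _ _ _ _).trans (x.bd_entry _ _ _ _)
      · exact (C.tgt_comp _ _ _ _).trans (y.bd_entry _ _ _ _)
    · rw [dif_neg (by omega), dif_neg (by omega)]
      have e := h'.2 δ hil (natCast_le_of_succ_le hl)
      cases ε <;> cases δ <;> simp [x.bd_entry, y.bd_entry, e]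
  val_top ε δ hl := by
    rw [dif_pos hij, dif_pos hij]
    exact StrictCatData.comp_congr _ _ _ (x.val_top _ _ _) (y.val_top _ _ _) _ _

theorem coskComp_val_of_lt {i j : ℕ} (hij : i < j) (hj : (j : ℕ∞) ≤ n) (x y : C.CoskCell j)
    (h : (C.coskGlobSet n).Composable hij hj x y) (ε : Bool) {l : ℕ} (hil : i < l) (hlj : l ≤ j)
    (hl : (l : ℕ∞) ≤ m) : (C.coskComp hij hj x y h).val ε hlj hl =
      C.comp hil hl (x.val ε hlj hl) (y.val ε hlj hl) (C.composable_coskVal h ε hil hlj hl) :=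
  dif_pos hil

theorem coskComp_val_of_le {i j : ℕ} (hij : i < j) (hj : (j : ℕ∞) ≤ n) (x y : C.CoskCell j)
    (h : (C.coskGlobSet n).Composable hij hj x y) (ε : Bool) {l : ℕ} (hli : l ≤ i) (hlj : l ≤ j)
    (hl : (l : ℕ∞) ≤ m) : (C.coskComp hij hj x y h).val ε hlj hl =
      bif ε then y.val true hlj hl else x.val false hlj hl :=
  dif_neg (by omega)

variable (n)

/-- The operations of the coskeleton. -/
abbrev coskData : StrictCatData.{u} n where
  toGlobSet := C.coskGlobSet n
  idt _ x := CoskCell.idt x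
  comp hij hj x y h := C.coskComp hij hj x y h

variable {n}

theorem coskData_idTo_val_of_le {i j : ℕ} (hij : i ≤ j) (hj : (j : ℕ∞) ≤ n)
    (x : C.CoskCell i) (ε : Bool) {l : ℕ} (hli : l ≤ i) (hl : (l : ℕ∞) ≤ m) :
    ((C.coskData n).idTo hij hj x : C.CoskCell j).val ε (hli.trans hij) hl =
      x.val ε hli hl := by
  induction j, hij using Nat.le_induction with
  | base => rw [StrictCatData.idTo_self]
  | succ j hij ih =>
    rw [StrictCatData.idTo_succ _ hij]
    exact (CoskCell.idt_val_of_le _ _ (hli.trans hij) _ _).trans (ih _)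

theorem coskData_idTo_val_of_ge {i j : ℕ} (hij : i ≤ j) (hj : (j : ℕ∞) ≤ n)
    (x : C.CoskCell i) (ε : Bool) {l : ℕ} (hil : i ≤ l) (hlj : l ≤ j) (hl : (l : ℕ∞) ≤ m) :
    ((C.coskData n).idTo hij hj x : C.CoskCell j).val ε hlj hl =
      C.idTo hil hl (x.val ε le_rfl (natCast_le_of_le hil hl)) := by
  induction j, hij using Nat.le_induction generalizing l with
  | base =>
    obtain rfl : l = i := by omega
    rw [StrictCatData.idTo_self, StrictCatData.idTo_self]
  | succ j hij ih =>
    rw [StrictCatData.idTo_succ _ hij]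
    rcases hlj.eq_or_lt with rfl | h
    · refine (CoskCell.idt_val_top _ _ _).trans ?_
      rw [StrictCatData.idTo_succ _ hij]
      exact congrArg _ (ih _ hij le_rfl _)
    · exact (CoskCell.idt_val_of_le _ _ (Nat.le_of_lt_succ h) _ _).trans (ih _ _ _ _)

variable (n)

/-- The coskeleton of a strict `m`-category, which is a strict `n`-category. -/
def cosk : StrictCat.{u} n where
  toStrictCatData := C.coskData n
  bd_idt ε j _ x := by
    refine CoskCell.ext ?_
    funext δ l hlj hl
    refine (CoskCell.idt_val_of_le _ _ hlj _ _).trans ?_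
    split_ifs with h
    · subst h
      exact CoskCell.val_top _ _ _ _
    · rfl
  bd_comp ε i j hij hj x y h h' := by
    refine CoskCell.ext ?_
    funext δ l hlj hl
    -- Here and in the axioms below, rows above the dimension of composition satisfy the axiom of
    -- `C`, while in the other rows composition merely selects entries.
    rcases lt_or_ge i l with hil | hil
    · exact (C.coskComp_val_of_lt _ _ _ _ h _ hil _ _).trans
        (C.coskComp_val_of_lt _ _ _ _ h' _ hil _ _).symm
    · have hne : l ≠ j := by omega
      refine (C.coskComp_val_of_le _ _ _ _ h _ hil _ _).trans
        (Eq.trans ?_ (C.coskComp_val_of_le _ _ _ _ h' _ hil _ _).symm)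
      cases δ <;> simp [hne]
  src_comp {j} hj x y h := by
    refine CoskCell.ext ?_
    funext δ l hlj hl
    refine (C.coskComp_val_of_le _ _ _ _ h _ hlj _ _).trans ?_
    have h' := (C.coskGlobSet_composable_iff _ _ _ _).mp h
    rcases hlj.eq_or_lt with rfl | hlt
    · simp
    · have := h'.2 true hlt hl
      cases δ <;> simp [hlt.ne, this]
  tgt_comp {j} hj x y h := by
    refine CoskCell.ext ?_
    funext δ l hlj hl
    refine (C.coskComp_val_of_le _ _ _ _ h _ hlj _ _).trans ?_
    have h' := (C.coskGlobSet_composable_iff _ _ _ _).mp h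
    rcases hlj.eq_or_lt with rfl | hlt
    · simp
    · have := h'.2 false hlt hl
      cases δ <;> simp [hlt.ne, this]
  id_comp {i j} hij hj x h := by
    refine CoskCell.ext ?_
    funext ε l hlj hl
    rcases lt_or_ge i l with hil | hli
    · refine (C.coskComp_val_of_lt _ _ _ _ h _ hil _ _).trans
        ((StrictCatData.comp_congr _ _ _ ?_ rfl _ (C.composable_idTo_left hil hl _)).trans
          (C.id_comp hil hl _ _))
      refine (C.coskData_idTo_val_of_ge _ _ _ _ hil.le _ _).trans (congrArg _ ?_)
      refine (C.coskGlobSet_bdTo_val _ _ _ _ _ _ _).trans ?_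
      rw [if_pos rfl]
      exact (CoskCell.bdTo_val _ _ _ hil _ _).symm
    · refine (C.coskComp_val_of_le _ _ _ _ h _ hli _ _).trans ?_
      cases ε
      · refine (C.coskData_idTo_val_of_le _ _ _ _ hli _).trans
          ((C.coskGlobSet_bdTo_val _ _ _ _ _ _ _).trans ?_)
        rw [ite_self]
      · rfl
  comp_id {i j} hij hj x h := by
    refine CoskCell.ext ?_
    funext ε l hlj hl
    rcases lt_or_ge i l with hil | hli
    · refine (C.coskComp_val_of_lt _ _ _ _ h _ hil _ _).trans
        ((StrictCatData.comp_congr _ _ _ rfl ?_ _ (C.composable_idTo_right hil hl _)).trans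
          (C.comp_id hil hl _ _))
      refine (C.coskData_idTo_val_of_ge _ _ _ _ hil.le _ _).trans (congrArg _ ?_)
      refine (C.coskGlobSet_bdTo_val _ _ _ _ _ _ _).trans ?_
      rw [if_pos rfl]
      exact (CoskCell.bdTo_val _ _ _ hil _ _).symm
    · refine (C.coskComp_val_of_le _ _ _ _ h _ hli _ _).trans ?_
      cases ε
      · rfl
      · refine (C.coskData_idTo_val_of_le _ _ _ _ hli _).trans
          ((C.coskGlobSet_bdTo_val _ _ _ _ _ _ _).trans ?_)
        rw [ite_self]
  assoc {i j} hij hj x y z hxy hyz h h' := by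
    refine CoskCell.ext ?_
    funext ε l hlj hl
    rcases lt_or_ge i l with hil | hli
    · refine (C.coskComp_val_of_lt _ _ _ _ h _ hil _ _).trans
        (Eq.trans ?_ (C.coskComp_val_of_lt _ _ _ _ h' _ hil _ _).symm)
      have cxy := C.composable_coskVal hxy ε hil hlj hl
      have cyz := C.composable_coskVal hyz ε hil hlj hl
      refine (StrictCatData.comp_congr _ _ _ (C.coskComp_val_of_lt _ _ _ _ hxy _ hil _ _) rfl _
        (C.composable_comp_left hil hl cxy cyz)).trans
        ((C.assoc hil hl _ _ _ _ _ _ (C.composable_comp_right hil hl cxy cyz)).trans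
        (StrictCatData.comp_congr _ _ _ rfl (C.coskComp_val_of_lt _ _ _ _ hyz _ hil _ _).symm _ _))
    · refine (C.coskComp_val_of_le _ _ _ _ h _ hli _ _).trans
        (Eq.trans ?_ (C.coskComp_val_of_le _ _ _ _ h' _ hli _ _).symm)
      cases ε
      · exact C.coskComp_val_of_le _ _ _ _ hxy false hli _ _
      · exact (C.coskComp_val_of_le _ _ _ _ hyz true hli _ _).symm
  idt_comp {i j} hij hj x y h h' := by
    refine CoskCell.ext ?_
    funext ε l hlj hl
    rcases lt_or_ge i l with hil | hli
    · refine Eq.trans ?_ (C.coskComp_val_of_lt _ _ _ _ h' _ hil _ _).symm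
      rcases hlj.eq_or_lt with rfl | hlt
      · refine (CoskCell.idt_val_top _ _ _).trans
          ((congrArg _ (C.coskComp_val_of_lt _ _ _ _ h _ hij _ _)).trans ?_)
        have c := C.composable_coskVal h ε hij le_rfl (natCast_le_of_succ_le hl)
        exact (C.idt_comp hij hl _ _ _ (C.composable_idt hij hl c)).trans
          (StrictCatData.comp_congr _ _ _ (CoskCell.idt_val_top _ _ _).symm
            (CoskCell.idt_val_top _ _ _).symm _ _)
      · have hlj' : l ≤ j := Nat.le_of_lt_succ hlt
        exact (CoskCell.idt_val_of_le _ _ hlj' _ _).trans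
          ((C.coskComp_val_of_lt _ _ _ _ h _ hil _ _).trans
          (StrictCatData.comp_congr _ _ _ (CoskCell.idt_val_of_le _ _ hlj' _ _).symm
            (CoskCell.idt_val_of_le _ _ hlj' _ _).symm _ _))
    · have hlj' : l ≤ j := hli.trans hij.le
      refine (CoskCell.idt_val_of_le _ _ hlj' _ _).trans
        ((C.coskComp_val_of_le _ _ _ _ h _ hli _ _).trans
        (Eq.trans ?_ (C.coskComp_val_of_le _ _ _ _ h' _ hli _ _).symm))
      rw [CoskCell.idt_val_of_le _ _ hlj', CoskCell.idt_val_of_le _ _ hlj']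
  exchange {i j k} hij hjk hk x x' y y' hxy hxy' hx hy h h' := by
    refine CoskCell.ext ?_
    funext ε l hlk hl
    rcases lt_or_ge j l with hjl | hlj
    · have hil : i < l := hij.trans hjl
      refine (C.coskComp_val_of_lt _ _ _ _ h _ hjl _ _).trans
        (Eq.trans ?_ (C.coskComp_val_of_lt _ _ _ _ h' _ hil _ _).symm)
      have cxy := C.composable_coskVal hxy ε hil hlk hl
      have cxy' := C.composable_coskVal hxy' ε hil hlk hl
      have cx := C.composable_coskVal hx ε hjl hlk hl
      have cy := C.composable_coskVal hy ε hjl hlk hl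
      refine (StrictCatData.comp_congr _ _ _ (C.coskComp_val_of_lt _ _ _ _ hxy _ hil _ _)
        (C.coskComp_val_of_lt _ _ _ _ hxy' _ hil _ _) _
        (C.composable_exchange_left hij hjl hl cxy cxy' cx cy)).trans
        ((C.exchange hij hjl hl _ _ _ _ cxy cxy' cx cy _
          (C.composable_exchange_right hij hjl hl cxy cx cy)).trans
        (StrictCatData.comp_congr _ _ _ (C.coskComp_val_of_lt _ _ _ _ hx _ hjl _ _).symm
          (C.coskComp_val_of_lt _ _ _ _ hy _ hjl _ _).symm _ _))
    · refine (C.coskComp_val_of_le _ _ _ _ h _ hlj _ _).trans ?_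
      rcases lt_or_ge i l with hil | hli
      · refine Eq.trans ?_ (C.coskComp_val_of_lt _ _ _ _ h' _ hil _ _).symm
        cases ε
        · exact (C.coskComp_val_of_lt _ _ _ _ hxy false hil _ _).trans
            (StrictCatData.comp_congr _ _ _ (C.coskComp_val_of_le _ _ _ _ hx false hlj _ _).symm
              (C.coskComp_val_of_le _ _ _ _ hy false hlj _ _).symm _ _)
        · exact (C.coskComp_val_of_lt _ _ _ _ hxy' true hil _ _).trans
            (StrictCatData.comp_congr _ _ _ (C.coskComp_val_of_le _ _ _ _ hx true hlj _ _).symm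
              (C.coskComp_val_of_le _ _ _ _ hy true hlj _ _).symm _ _)
      · refine Eq.trans ?_ (C.coskComp_val_of_le _ _ _ _ h' _ hli _ _).symm
        cases ε
        · exact (C.coskComp_val_of_le _ _ _ _ hxy false hli _ _).trans
            (C.coskComp_val_of_le _ _ _ _ hx false hlj _ _).symm
        · exact (C.coskComp_val_of_le _ _ _ _ hxy' true hli _ _).trans
            (C.coskComp_val_of_le _ _ _ _ hy true hlj _ _).symm

end StrictCat

/-! ## The universal property of coskeleta -/

namespace GlobSet

theorem bd_bdTo {n : ℕ∞} (X : GlobSet.{u} n) (δ ε : Bool) {l j : ℕ} (hlj : l + 1 ≤ j)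
    (hj : (j : ℕ∞) ≤ n) (x : X.cell j hj) :
    X.bd δ (natCast_le_of_le hlj hj) (X.bdTo ε hlj hj x) =
      X.bdTo δ (Nat.le_of_succ_le hlj) hj x := by
  have h := X.bdTo_bdTo δ ε (Nat.lt_succ_self l) hlj hj x
  rw [X.bdTo_succ _ le_rfl, X.bdTo_self] at h
  exact h

end GlobSet

namespace StrictCat

variable {m n : ℕ∞}

theorem bdTo_comp_of_le (C : StrictCat.{u} n) (ε : Bool) {l i j : ℕ} (hli : l ≤ i) (hij : i < j)
    (hj : (j : ℕ∞) ≤ n) (u v : C.cell j hj) (h : C.Composable hij hj u v) :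
    C.bdTo ε (hli.trans hij.le) hj (C.comp hij hj u v h) =
      bif ε then C.bdTo true (hli.trans hij.le) hj v
      else C.bdTo false (hli.trans hij.le) hj u := by
  rcases hli.eq_or_lt with rfl | hlt
  · cases ε
    · exact (C.bdTo_comp hij hj u v h).1
    · exact (C.bdTo_comp hij hj u v h).2
  · rw [← C.bdTo_bdTo ε ε hlt hij.le]
    cases ε
    · rw [(C.bdTo_comp hij hj u v h).1, C.bdTo_bdTo _ _ hlt]
      rfl
    · rw [(C.bdTo_comp hij hj u v h).2, C.bdTo_bdTo _ _ hlt]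
      rfl

variable {C : StrictCat.{u} m} {D : StrictCat.{u} n} (hmn : m ≤ n)

/-- The table of iterated sources and targets of the image of a cell. -/
def coskTable (g : (trunc hmn).obj D ⟶ C) {j : ℕ} (hj : (j : ℕ∞) ≤ n) (x : D.cell j hj) :
    C.CoskCell j where
  val ε l hlj hl := g.app hl (D.bdTo ε hlj hj x)
  bd_entry δ ε l hlj hl := by
    exact (g.app_bd δ hl (D.bdTo ε hlj hj x)).trans
      (congrArg (g.app _) (D.bd_bdTo δ ε hlj hj x))
  val_top ε δ hl := by rw [GlobSet.bdTo_self, GlobSet.bdTo_self]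

theorem coskTable_bd (g : (trunc hmn).obj D ⟶ C) (ε : Bool) {j : ℕ}
    (hj : ((j + 1 : ℕ) : ℕ∞) ≤ n) (x : D.cell (j + 1) hj) :
    (coskTable hmn g hj x).bd ε = coskTable hmn g (natCast_le_of_succ_le hj) (D.bd ε hj x) := by
  refine CoskCell.ext ?_
  funext δ l hlj hl
  refine congrArg (g.app hl) ?_
  rcases hlj.eq_or_lt with rfl | hlt
  · rw [if_pos rfl, D.bdTo_succ _ le_rfl, D.bdTo_self, D.bdTo_self]
  · rw [if_neg hlt.ne, D.bdTo_bd _ _ hlt]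

/-- The functor to the coskeleton that corresponds to a functor from the truncation. -/
def coskLift (g : (trunc hmn).obj D ⟶ C) : D ⟶ C.cosk n where
  app hj x := coskTable hmn g hj x
  app_bd ε _ hj x := coskTable_bd hmn g ε hj x
  app_idt {j} hj x := by
    refine CoskCell.ext ?_
    funext ε l hlj hl
    rcases hlj.eq_or_lt with rfl | hlt
    · refine Eq.trans ?_ (CoskCell.idt_val_top _ _ _).symm
      refine (congrArg (g.app hl) (D.bdTo_self _ _ _)).trans ((g.app_idt hl x).trans ?_)
      exact congrArg (fun y => C.idt hl (g.app _ y)) (D.bdTo_self _ _ _).symm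
    · have hlj' := Nat.le_of_lt_succ hlt
      refine Eq.trans (congrArg (g.app hl) ?_)
        (CoskCell.idt_val_of_le (coskTable hmn g _ x) ε hlj' hlj hl).symm
      rw [D.bdTo_succ _ hlj', D.bd_idt]
  app_comp {i j} hij hj x y h := by
    refine CoskCell.ext ?_
    funext ε l hlj hl
    have h' : (C.coskGlobSet n).Composable hij hj (coskTable hmn g hj x) (coskTable hmn g hj y) :=
      GlobSet.Hom.composable (X := D.toGlobSet) (Y := C.coskGlobSet n)
        ⟨fun hj x => coskTable hmn g hj x, fun ε _ hj x => coskTable_bd hmn g ε hj x⟩ h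
    rcases lt_or_ge i l with hil | hli
    · refine Eq.trans ?_ (C.coskComp_val_of_lt _ _ _ _ h' _ hil _ _).symm
      refine (congrArg (g.app hl) (D.bdTo_comp_of_lt ε hil hlj hj x y h)).trans ?_
      exact g.app_comp hil hl _ _ ((GlobSet.trunc_composable hmn D.toGlobSet hil hl _ _).mpr
        (D.composable_bdTo ε hil hlj hj h))
    · refine Eq.trans ?_ (C.coskComp_val_of_le _ _ _ _ h' _ hli _ _).symm
      refine (congrArg (g.app hl) (D.bdTo_comp_of_le ε hli hij hj x y h)).trans ?_
      cases ε <;> rfl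

variable (C)

/-- The counit of the adjunction between truncation and coskeleton. -/
def coskCounit : (trunc hmn).obj (C.cosk n) ⟶ C where
  app hl x := CoskCell.val x false le_rfl hl
  app_bd ε l hl x := by
    refine (CoskCell.bd_entry x ε false le_rfl hl).trans ?_
    refine Eq.trans ?_ (CoskCell.bd_val ε x false l le_rfl _).symm
    simp
  app_idt hl x := CoskCell.idt_val_top x false hl
  app_comp hil hl x y h := C.coskComp_val_of_lt hil (hl.trans hmn) x y
    ((GlobSet.trunc_composable hmn (C.coskGlobSet n) hil hl x y).mp h) false hil le_rfl hl

/-- The globular inverse of the counit. -/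
def coskCounitInv : C.toGlobSet ⟶ (GlobSet.trunc hmn).obj (C.coskGlobSet n) where
  app hl x :=
    { val := fun ε _ hil _ => C.bdTo ε hil hl x
      bd_entry := fun δ ε _ hil _ => C.bd_bdTo δ ε hil hl x
      val_top := fun _ _ _ => by rw [GlobSet.bdTo_self, GlobSet.bdTo_self] }
  app_bd ε j hj x := by
    refine CoskCell.ext ?_
    funext δ l hlj hl
    change C.bdTo (if l = j then ε else δ) _ hj x = C.bdTo δ hlj _ (C.bd ε hj x)
    rcases hlj.eq_or_lt with rfl | hlt
    · rw [if_pos rfl, C.bdTo_succ _ le_rfl, C.bdTo_self, C.bdTo_self]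
    · rw [if_neg hlt.ne, C.bdTo_bd _ _ hlt]

/-- The truncation of the coskeleton of `C` is `C`. -/
def coskIso : (GlobSet.trunc hmn).obj (C.coskGlobSet n) ≅ C.toGlobSet where
  hom := (forget m).map (C.coskCounit hmn)
  inv := C.coskCounitInv hmn
  hom_inv_id := by
    ext k hk x
    refine CoskCell.ext ?_
    funext ε l hlk hl
    change C.bdTo ε hlk hk (CoskCell.val x false le_rfl hk) = CoskCell.val x ε hlk hl
    rcases hlk.eq_or_lt with rfl | hlt
    · rw [C.bdTo_self]
      exact CoskCell.val_top _ _ _ _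
    · exact CoskCell.bdTo_val _ _ _ hlt _ _
  inv_hom_id := by
    ext k hk x
    exact C.bdTo_self _ _ _

variable {C}

theorem coskLift_counit (g : (trunc hmn).obj D ⟶ C) :
    (trunc hmn).map (coskLift hmn g) ≫ C.coskCounit hmn = g := by
  apply Hom.ext
  funext k hk x
  exact congrArg (g.app hk) (D.bdTo_self _ _ _)

/-- The entry of sign `ε` in row `l` of `h x` is the top entry of `h` at the iterated boundary of
`x` in dimension `l ≤ m`. So `h` is determined by its truncation. -/
theorem coskLift_trunc_counit (h : D ⟶ C.cosk n) :
    coskLift hmn ((trunc hmn).map h ≫ C.coskCounit hmn) = h := by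
  apply Hom.ext
  funext k hk x
  refine CoskCell.ext ?_
  funext ε l hlk hl
  change CoskCell.val (h.app (hl.trans hmn) (D.bdTo ε hlk hk x)) false le_rfl hl =
    CoskCell.val (h.app hk x) ε hlk hl
  have e := congrArg (fun y : C.CoskCell l => y.val false le_rfl hl)
    (h.app_bdTo ε hlk hk x).symm
  refine e.trans ((C.coskGlobSet_bdTo_val ε hlk hk _ false le_rfl hl).trans ?_)
  rw [if_pos rfl]

/-- Functors from the truncation of `D` to `C` are functors from `D` to the coskeleton of `C`. -/
def coskEquiv : ((trunc hmn).obj D ⟶ C) ≃ (D ⟶ C.cosk n) where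
  toFun := coskLift hmn
  invFun h := (trunc hmn).map h ≫ C.coskCounit hmn
  left_inv := coskLift_counit hmn
  right_inv := coskLift_trunc_counit hmn

/-! ## Truncated free strict categories -/

section TruncAdjunction

variable {F : GlobSet.{u} n ⥤ StrictCat.{u} n} (adj : F ⊣ forget n)

/-- The inclusion of generators in a truncated free strict category. -/
def truncUnit (X : GlobSet.{u} m) :
    X ⟶ (forget m).obj ((trunc hmn).obj (F.obj ((GlobSet.incl m n).obj X))) :=
  (GlobSet.inclUnit hmn).app X ≫
    (GlobSet.trunc hmn).map (adj.unit.app ((GlobSet.incl m n).obj X))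

theorem truncUnit_naturality {X Y : GlobSet.{u} m} (f : X ⟶ Y) :
    f ≫ truncUnit hmn adj Y = truncUnit hmn adj X ≫
      (forget m).map ((trunc hmn).map (F.map ((GlobSet.incl m n).map f))) :=
  congrArg (fun a => (GlobSet.inclUnit hmn).app X ≫ (GlobSet.trunc hmn).map a)
    (adj.unit.naturality ((GlobSet.incl m n).map f))

/-- The universal property of truncated free strict categories. -/
def truncHomEquiv (X : GlobSet.{u} m) (C : StrictCat.{u} m) :
    ((trunc hmn).obj (F.obj ((GlobSet.incl m n).obj X)) ⟶ C) ≃ (X ⟶ (forget m).obj C) :=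
  (coskEquiv hmn).trans <| (adj.homEquiv _ _).trans <|
    ((GlobSet.inclAdj hmn).homEquiv _ _).trans (C.coskIso hmn).homToEquiv

/-- The chain of adjunction bijections is just restriction to the generators, which gives naturality
and determination by generators. -/
theorem truncHomEquiv_apply (X : GlobSet.{u} m) (C : StrictCat.{u} m)
    (g : (trunc hmn).obj (F.obj ((GlobSet.incl m n).obj X)) ⟶ C) :
    truncHomEquiv hmn adj X C g = truncUnit hmn adj X ≫ (forget m).map g := by
  conv_rhs => rw [← coskLift_counit hmn g]
  rfl

/-- Inclusion, free strict category and truncation yield free strict `m`-categories. -/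
def truncAdj : (GlobSet.incl m n ⋙ F ⋙ trunc hmn) ⊣ forget.{u} m :=
  Adjunction.mkOfHomEquiv
    { homEquiv := truncHomEquiv hmn adj
      homEquiv_naturality_left_symm := fun {X' X C} f g => by
        have e := (truncHomEquiv_apply hmn adj X C _).symm.trans
          ((truncHomEquiv hmn adj X C).apply_symm_apply g)
        rw [Equiv.symm_apply_eq, truncHomEquiv_apply, Functor.map_comp]
        refine (congrArg (fun a => f ≫ a) e).symm.trans ?_
        rw [← Category.assoc, truncUnit_naturality, Category.assoc]
        rfl
      homEquiv_naturality_right := fun f g => by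
        rw [truncHomEquiv_apply, truncHomEquiv_apply, Functor.map_comp, Category.assoc] }

end TruncAdjunction

end StrictCat

/-! ## Comparison in finite dimensions -/

section AlgebraFunctors

variable {C : Type u₁} [Category.{v₁} C] {D : Type u₂} [Category.{v₂} D]
  {T : CategoryTheory.Monad D}

/-- The functor to algebras given by a functor and natural structure maps. -/
def algebraLift (P : C ⥤ D) (a : ∀ X, T.obj (P.obj X) ⟶ P.obj X)
    (unit : ∀ X, T.η.app (P.obj X) ≫ a X = 𝟙 _)
    (assoc : ∀ X, T.μ.app (P.obj X) ≫ a X = T.map (a X) ≫ a X)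
    (h : ∀ {X Y : C} (f : X ⟶ Y), T.map (P.map f) ≫ a Y = a X ≫ P.map f) :
    C ⥤ T.Algebra where
  obj X := { A := P.obj X, a := a X, unit := unit X, assoc := assoc X }
  map f := { f := P.map f, h := h f }

/-- With the underlying functor fixed, equality of functors to algebras reduces to equality of
structure maps, with no transport between objects. -/
theorem algebraLift_congr (P : C ⥤ D) {a b : ∀ X, T.obj (P.obj X) ⟶ P.obj X} (hab : a = b)
    (ua aa ha ub ab hb) :
    algebraLift (T := T) P a ua aa ha = algebraLift P b ub ab hb := by
  subst hab
  rfl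

end AlgebraFunctors

namespace StrictCat

variable {m n : ℕ∞} (hmn : m ≤ n) {F : GlobSet.{u} n ⥤ StrictCat.{u} n} (adj : F ⊣ forget n)

theorem truncAdj_unit (X : GlobSet.{u} m) :
    (truncAdj hmn adj).unit.app X = truncUnit hmn adj X :=
  truncHomEquiv_apply hmn adj X _ (𝟙 _)

/-- A functor out of a truncated free strict category is determined by its restriction to the
generators. -/
theorem truncUnit_hom_ext {X : GlobSet.{u} m} {C : StrictCat.{u} m}
    {g h : (trunc hmn).obj (F.obj ((GlobSet.incl m n).obj X)) ⟶ C}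
    (e : truncUnit hmn adj X ≫ (forget m).map g = truncUnit hmn adj X ≫ (forget m).map h) :
    g = h :=
  (truncHomEquiv hmn adj X C).injective <|
    (truncHomEquiv_apply hmn adj X C g).trans (e.trans (truncHomEquiv_apply hmn adj X C h).symm)

/-- The multiplication of the truncated monad underlies a functor. -/
def truncMul (X : GlobSet.{u} m) :
    (trunc hmn).obj (F.obj ((GlobSet.incl m n).obj ((forget m).obj
      ((trunc hmn).obj (F.obj ((GlobSet.incl m n).obj X)))))) ⟶
    (trunc hmn).obj (F.obj ((GlobSet.incl m n).obj X)) :=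
  (trunc hmn).map (F.map ((GlobSet.inclCounit hmn).app
    ((forget n).obj (F.obj ((GlobSet.incl m n).obj X)))) ≫ adj.counit.app _)

/-- Both sides are the identity on generators: one by the left unit law of the truncated monad, the
other by a triangle identity. -/
theorem truncMul_eq (X : GlobSet.{u} m) :
    truncMul hmn adj X = (truncAdj hmn adj).counit.app
      ((trunc hmn).obj (F.obj ((GlobSet.incl m n).obj X))) := by
  apply truncUnit_hom_ext hmn adj
  refine Eq.trans ((GlobSet.truncMonad adj.toMonad hmn).left_unit X) ?_
  have e := (truncAdj hmn adj).right_triangle_components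
    ((trunc hmn).obj (F.obj ((GlobSet.incl m n).obj X)))
  rw [truncAdj_unit] at e
  exact e.symm

/-- The monad of the adjunction in dimension `m` is the truncated monad. -/
def truncMonadIso : (truncAdj hmn adj).toMonad ≅ GlobSet.truncMonad adj.toMonad hmn :=
  -- The two monads have the same underlying functor by definition, so identities serve as
  -- components.
  MonadIso.mk (NatIso.ofComponents (fun X => Iso.refl
      ((forget m).obj ((trunc hmn).obj (F.obj ((GlobSet.incl m n).obj X))))) (fun _ => rfl))
    (fun X => truncAdj_unit hmn adj X)
    (fun X => by
      have e := congrArg (forget m).map (truncMul_eq hmn adj X).symm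
      refine Eq.trans e ?_
      refine Eq.trans ?_ (congrArg (fun a => a ≫ (forget m).map (truncMul hmn adj X))
        (congrArg (fun a => a ≫ 𝟙 _)
          ((GlobSet.truncMonad adj.toMonad hmn).map_id _))).symm
      rfl)

/-- The comparison functor to algebras of the truncated monad. -/
def truncComparison : StrictCat.{u} m ⥤ GlobSet.Alg adj.toMonad hmn :=
  Monad.comparison (truncAdj hmn adj) ⋙
    (Monad.algebraEquivOfIsoMonads (truncMonadIso hmn adj)).functor

instance : (truncComparison hmn adj).IsEquivalence :=
  have := comparison_isEquivalence (truncAdj hmn adj)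
  Functor.isEquivalence_trans _ _

theorem truncComparison_forget :
    truncComparison hmn adj ⋙ Monad.forget (GlobSet.truncMonad adj.toMonad hmn) = forget m :=
  rfl

/-- The change of monads has identity components and leaves the structure map unaltered. -/
theorem truncComparison_a (C : StrictCat.{u} m) :
    ((truncComparison hmn adj).obj C).a = (forget m).map ((truncAdj hmn adj).counit.app C) :=
  rfl

/-- An algebra structure that underlies a functor is the one given by the comparison functor. -/
theorem eq_truncComparison_a (C : StrictCat.{u} m)
    (g : (trunc hmn).obj (F.obj ((GlobSet.incl m n).obj ((forget m).obj C))) ⟶ C)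
    (hg : truncUnit hmn adj ((forget m).obj C) ≫ (forget m).map g = 𝟙 _) :
    (forget m).map g = ((truncComparison hmn adj).obj C).a := by
  rw [truncComparison_a]
  congr 1
  apply truncUnit_hom_ext hmn adj
  rw [hg, ← truncAdj_unit]
  exact ((truncAdj hmn adj).right_triangle_components C).symm

/-! ### Compatibility of the comparison functors with truncation -/

theorem comparison_algTruncTop :
    Monad.comparison adj ⋙ GlobSet.algTruncTop adj.toMonad hmn =
      trunc hmn ⋙ truncComparison hmn adj := by
  let G := Monad.comparison adj ⋙ GlobSet.algTruncTop adj.toMonad hmn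
  let H := trunc hmn ⋙ truncComparison hmn adj
  refine algebraLift_congr (T := GlobSet.truncMonad adj.toMonad hmn) (trunc hmn ⋙ forget m)
    (a := fun C => (G.obj C).a) (b := fun C => (H.obj C).a) ?_
    (fun C => (G.obj C).unit) (fun C => (G.obj C).assoc) (fun f => (G.map f).h)
    (fun C => (H.obj C).unit) (fun C => (H.obj C).assoc) (fun f => (H.map f).h)
  funext C
  -- The truncated structure map underlies the displayed functor, and the unit law of the truncated
  -- algebra is exactly the statement that it is the identity on generators.
  exact eq_truncComparison_a hmn adj ((trunc hmn).obj C)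
    ((trunc hmn).map (F.map ((GlobSet.inclCounit hmn).app ((forget n).obj C)) ≫
      adj.counit.app C)) (G.obj C).unit

theorem truncComparison_algTrunc {l : ℕ∞} (hml : m ≤ l) (hln : l ≤ n) :
    truncComparison hln adj ⋙ GlobSet.algTrunc adj.toMonad hml hln =
      trunc hml ⋙ truncComparison (hml.trans hln) adj := by
  let G := truncComparison hln adj ⋙ GlobSet.algTrunc adj.toMonad hml hln
  let H := trunc hml ⋙ truncComparison (hml.trans hln) adj
  refine algebraLift_congr (T := GlobSet.truncMonad adj.toMonad (hml.trans hln))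
    (trunc hml ⋙ forget m)
    (a := fun C => (G.obj C).a) (b := fun C => (H.obj C).a) ?_
    (fun C => (G.obj C).unit) (fun C => (G.obj C).assoc) (fun f => (G.map f).h)
    (fun C => (H.obj C).unit) (fun C => (H.obj C).assoc) (fun f => (H.map f).h)
  funext C
  -- As before, but the functor is the comparison of truncated free categories induced by the counit
  -- $\iota$, followed by the truncated evaluation in dimension `l`.
  exact eq_truncComparison_a (hml.trans hln) adj ((trunc hml).obj C)
    ((trunc (hml.trans hln)).map (F.map ((GlobSet.inclTruncHom hml n).app ((forget l).obj C))) ≫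
      (trunc hml).map ((truncAdj hln adj).counit.app C)) (G.obj C).unit

end StrictCat

theorem mainTheorem8 :
    (StrictCat.forget.{u} ⊤).IsRightAdjoint ∧
    ∀ (F : GlobSet.{u} ⊤ ⥤ StrictCat.{u} ⊤) (adj : F ⊣ StrictCat.forget.{u} ⊤),
      (CategoryTheory.Monad.comparison adj).IsEquivalence ∧
      CategoryTheory.Monad.comparison adj ⋙ CategoryTheory.Monad.forget adj.toMonad =
        StrictCat.forget ⊤ ∧
      ∃ H : ∀ k : ℕ, StrictCat.{u} (k : ℕ∞) ⥤
          GlobSet.Alg (m := (k : ℕ∞)) adj.toMonad le_top,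
        (∀ k : ℕ, (H k).IsEquivalence) ∧
        (∀ k : ℕ,
          H (k + 1) ⋙ GlobSet.algTrunc adj.toMonad (Nat.cast_le.mpr (Nat.le_succ k)) le_top =
            StrictCat.trunc (Nat.cast_le.mpr (Nat.le_succ k)) ⋙ H k) ∧
        (∀ k : ℕ,
          CategoryTheory.Monad.comparison adj ⋙ GlobSet.algTruncTop adj.toMonad le_top =
            StrictCat.trunc le_top ⋙ H k) ∧
        (∀ k : ℕ,
          H k ⋙ CategoryTheory.Monad.forget
              (GlobSet.truncMonad (m := (k : ℕ∞)) adj.toMonad le_top) =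
            StrictCat.forget (k : ℕ∞)) :=
  ⟨StrictCat.forget_isRightAdjoint ⊤, fun _ adj =>
    ⟨StrictCat.comparison_isEquivalence adj, rfl,
      fun _ => StrictCat.truncComparison le_top adj, fun _ => inferInstance,
      fun _ => StrictCat.truncComparison_algTrunc adj _ le_top,
      fun _ => StrictCat.comparison_algTruncTop le_top adj,
      fun _ => StrictCat.truncComparison_forget le_top adj⟩⟩
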